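/- **Setting.** Let $\Omega=(l,r)\subset\mathbb R$ be a bounded open interval, $l<r$, with boundary $\Gamma=\{l,r\}$. Let the water depth $H$ and the topography $z_b$ be $C^1$ functions on $[l,r]$, and assume $H\ge H_0$ on $[l,r]$ for a constant $H_0>0$. For smooth $f$ and $\mathbf v=(v_1,v_2)$ put $$\nabla_{sw} f=\begin{pmatrix}H\,\partial_x f+f\,\partial_x(H+2z_b)\\-2f\end{pmatrix},\qquad \operatorname{div}_{sw}\mathbf v=\partial_x(Hv_1)-v_1\,\partial_x(H+2z_b)+2v_2 .$$ For $q\in L^2(\Omega)$ and $\mathbf v\in (L^2(\Omega))^2$ these are understood in the sense of distributions: $\nabla_{sw}q=\mathbf G$ means $\int_\Omega \mathbf G\cdot\boldsymbol\Phi\,dx=-\int_\Omega q\,\operatorname{div}_{sw}\boldsymbol\Phi\,dx$ for all $\boldsymbol\Phi\in C_c^\infty(\Omega)^2$, and $\operatorname{div}_{sw}\mathbf v=g$ means $\int_\Omega g\,\varphi\,dx=-\int_\Omega\mathbf v\cdot\nabla_{sw}\varphi\,dx$ for all $\varphi\in C_c^\infty(\Omega)$. Let $$Q=\{q\in L^2(\Omega)\mid\nabla_{sw}q\in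 (L^2(\Omega))^2\},\qquad V_0=\{\mathbf v\in (L^2(\Omega))^2\mid\operatorname{div}_{sw}\mathbf v\in L^2(\Omega),\ v_1|_\Gamma=0\},$$ where $v_1|_\Gamma=0$ means that $v_1$ agrees almost everywhere with a continuous function on $[l,r]$ vanishing at $l$ and $r$. Let $$a(\mathbf u,\mathbf v)=\int_\Omega H\,\mathbf u\cdot\mathbf v\,dx,\qquad b(\mathbf v,q)=-\int_\Omega\operatorname{div}_{sw}(\mathbf v)\,q\,dx,$$ $$\ker\mathcal B=\{\mathbf v\in V_0\mid b(\mathbf v,q)=0\ \ \forall q\in Q\},\qquad \ker\mathcal B^t=\{q\in Q\mid b(\mathbf v,q)=0\ \ \forall\mathbf v\in V_0\}.$$ **Theorem.** Write $\|\cdot\|$ for the $L^2$ norms. 1. (Coercivity.) $a(\mathbf v,\mathbf v)\ge H_0\|\mathbf v\|^2$ for all $\mathbf v\in V_0$, and $a(\mathbf v,\mathbf v)\ge H_0\,(\|\mathbf v\|^2+\|\operatorname{div}_{sw}\mathbf v\|^2)$ for all $\mathbf v\in\ker\mathcal B$. 2. (Kernel.) $\ker\mathcal B^t=\{q\in Q\mid\int_\Omega\nabla_{sw}q\cdot\mathbf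 v\,dx=0\ \ \forall\mathbf v\in V_0\}$; if $q\in Q$ and $\nabla_{sw}q=0$, then $q=0$; and $\ker\mathcal B^t=\{0\}$. 3. (Inf-sup condition.) There is $\gamma>0$ with $$\gamma<\inf_{q\in Q\setminus\{0\}}\ \sup_{\mathbf v\in V_0\setminus\{0\}}\frac{b(\mathbf v,q)}{\|\mathbf v\|_{V_0}\,\|q\|_Q},$$ for each of the following two choices of norms: $\|\mathbf v\|_{V_0}=\|\mathbf v\|$ and $\|q\|_Q=(\|q\|^2+\|\nabla_{sw}q\|^2)^{1/2}$; or $\|\mathbf v\|_{V_0}=(\|\mathbf v\|^2+\|\operatorname{div}_{sw}\mathbf v\|^2)^{1/2}$ and $\|q\|_Q=\|q\|$ (the constant $\gamma$ may depend on the choice). 4. (Well-posedness.) For every $\Delta t>0$ and every $\mathbf u^{n+1/2}\in (L^2(\Omega))^2$ there is exactly one pair $(\mathbf u,p)\in V_0\times Q$ such that $$\frac1{\Delta t}\,a(\mathbf u,\mathbf v)+b(\mathbf v,p)=\frac1{\Delta t}\,a(\mathbf u^{n+1/2},\mathbf v)\quad\forall\,\mathbf v\in V_0,\qquad b(\mathbf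 u,q)=0\quad\forall\,q\in Q .$$ -/

import Mathlib

open MeasureTheory Set
open scoped ContDiff

noncomputable section

namespace ShallowWater

/-- The plane `ℝ²` with its Euclidean norm; a velocity `v = (v₁, v₂)` has coordinates
`v 0 = v₁` and `v 1 = v₂`. -/
abbrev Plane : Type := EuclideanSpace ℝ (Fin 2)

/-- Lebesgue measure on the interval `Ω = (l, r)`. -/
abbrev vol (l r : ℝ) : Measure ℝ := volume.restrict (Ioo l r)

/-- The space `L²(Ω)`. -/
abbrev L2 (l r : ℝ) : Type := Lp ℝ 2 (vol l r)

/-- The space `(L²(Ω))²`, with `‖v‖² = ∫ (v₁² + v₂²)`. -/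
abbrev L2Vec (l r : ℝ) : Type := Lp Plane 2 (vol l r)

/-- The shallow water gradient of a smooth function,
`∇_sw f = (H ∂ₓf + f ∂ₓ(H + 2 z_b), -2 f)`. -/
def smoothGrad (H zb f : ℝ → ℝ) (x : ℝ) : Plane :=
  !₂[H x * deriv f x + f x * deriv (fun y => H y + 2 * zb y) x, -2 * f x]

/-- The shallow water divergence of a smooth vector field,
`div_sw v = ∂ₓ(H v₁) - v₁ ∂ₓ(H + 2 z_b) + 2 v₂`. -/
def smoothDiv (H zb : ℝ → ℝ) (v : ℝ → Plane) (x : ℝ) : ℝ :=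
  deriv (fun y => H y * v y 0) x - v x 0 * deriv (fun y => H y + 2 * zb y) x + 2 * v x 1

/-- Test functions on `Ω = (l, r)`: smooth with compact support contained in `Ω`. -/
def IsTest {E : Type*} [NormedAddCommGroup E] [NormedSpace ℝ E] (l r : ℝ) (φ : ℝ → E) : Prop :=
  ContDiff ℝ ∞ φ ∧ HasCompactSupport φ ∧ tsupport φ ⊆ Ioo l r

/-- `G = ∇_sw q` in the sense of distributions on `Ω`:
`∫ G · Φ = - ∫ q div_sw Φ` for all test vector fields `Φ`. -/
def HasWeakGrad {l r : ℝ} (H zb : ℝ → ℝ) (q : L2 l r) (G : L2Vec l r) : Prop :=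
  ∀ Φ : ℝ → Plane, IsTest l r Φ →
    ∫ x, inner ℝ (G x) (Φ x) ∂(vol l r) = -∫ x, q x * smoothDiv H zb Φ x ∂(vol l r)

/-- `g = div_sw v` in the sense of distributions on `Ω`:
`∫ g φ = - ∫ v · ∇_sw φ` for all test functions `φ`. -/
def HasWeakDiv {l r : ℝ} (H zb : ℝ → ℝ) (v : L2Vec l r) (g : L2 l r) : Prop :=
  ∀ φ : ℝ → ℝ, IsTest l r φ →
    ∫ x, g x * φ x ∂(vol l r) = -∫ x, inner ℝ (v x) (smoothGrad H zb φ x) ∂(vol l r)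

/-- A function with zero integral against all test functions vanishes almost everywhere. -/
theorem ae_zero_of_test {l r : ℝ} (f : L2 l r)
    (h : ∀ φ : ℝ → ℝ, IsTest l r φ → ∫ x, f x * φ x ∂(vol l r) = 0) :
    ∀ᵐ x ∂(vol l r), f x = 0 := by
  rw [ae_restrict_iff' measurableSet_Ioo]
  refine isOpen_Ioo.ae_eq_zero_of_integral_contDiff_smul_eq_zero ?_ ?_
  · have h1 : Integrable f (vol l r) := (Lp.memLp f).integrable (by norm_num)
    exact IntegrableOn.locallyIntegrableOn h1
  · intro g hg hc hs
    rw [← setIntegral_eq_integral_of_forall_compl_eq_zero (s := Ioo l r), ← h g ⟨hg, hc, hs⟩]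
    · simp [mul_comm]
    · intro x hx
      have : g x = 0 := by
        by_contra h0
        exact hx (hs (subset_tsupport g h0))
      simp [this]

theorem integrable_mul_test {l r : ℝ} (f : L2 l r) {φ : ℝ → ℝ} (hφ : IsTest l r φ) :
    Integrable (fun x => f x * φ x) (vol l r) :=
  (Lp.memLp f).integrable_mul
    (hφ.1.continuous.memLp_of_hasCompactSupport hφ.2.1 : MemLp φ 2 (vol l r))

/-- The weak shallow water divergence is unique. -/
theorem HasWeakDiv.unique {l r : ℝ} {H zb : ℝ → ℝ} {v : L2Vec l r} {g g' : L2 l r}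
    (h : HasWeakDiv H zb v g) (h' : HasWeakDiv H zb v g') : g = g' := by
  rw [← sub_eq_zero]
  apply Lp.ext
  have key := ae_zero_of_test (g - g') (fun φ hφ => by
    have e : ∫ x, (g - g') x * φ x ∂(vol l r)
        = ∫ x, (g x * φ x - g' x * φ x) ∂(vol l r) := by
      apply integral_congr_ae
      filter_upwards [Lp.coeFn_sub g g'] with x hx
      rw [hx, Pi.sub_apply, sub_mul]
    rw [e, integral_sub (integrable_mul_test g hφ) (integrable_mul_test g' hφ), h φ hφ, h' φ hφ,
      sub_self])
  filter_upwards [key, Lp.coeFn_zero ℝ 2 (vol l r)] with x h1 h2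
  rw [h1, h2, Pi.zero_apply]

/-- The weak shallow water gradient is unique. -/
theorem HasWeakGrad.unique {l r : ℝ} {H zb : ℝ → ℝ} {q : L2 l r} {G G' : L2Vec l r}
    (h : HasWeakGrad H zb q G) (h' : HasWeakGrad H zb q G') : G = G' := by
  have coord : ∀ (G : L2Vec l r) (i : Fin 2), MemLp (fun x => G x i) 2 (vol l r) := fun G i => by
    simpa [EuclideanSpace.inner_single_right] using
      (Lp.memLp G).inner_const (𝕜 := ℝ) (EuclideanSpace.single i (1 : ℝ))
  have main : ∀ i : Fin 2, ∀ᵐ x ∂(vol l r), G x i = G' x i := by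
    intro i
    have hm := (coord G i).sub (coord G' i)
    have key := ae_zero_of_test (hm.toLp _) (fun φ hφ => by
      have tΦ : IsTest l r (fun x => φ x • (EuclideanSpace.single i (1 : ℝ) : Plane)) :=
        ⟨hφ.1.smul contDiff_const, hφ.2.1.smul_right,
          (tsupport_smul_subset_left φ _).trans hφ.2.2⟩
      have ip : ∀ F : L2Vec l r, (fun x => inner ℝ (F x)
          (φ x • (EuclideanSpace.single i (1 : ℝ) : Plane))) = fun x => F x i * φ x := by
        intro F; ext x
        simp [inner_smul_right, EuclideanSpace.inner_single_right, mul_comm]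
      have e1 := h _ tΦ
      have e2 := h' _ tΦ
      rw [ip] at e1 e2
      have hφ2 : MemLp φ 2 (vol l r) := hφ.1.continuous.memLp_of_hasCompactSupport hφ.2.1
      have e : ∫ x, (hm.toLp _) x * φ x ∂(vol l r)
          = ∫ x, (G x i * φ x - G' x i * φ x) ∂(vol l r) := by
        apply integral_congr_ae
        filter_upwards [hm.coeFn_toLp] with x hx
        rw [hx, Pi.sub_apply, sub_mul]
      have i1 : Integrable (fun x => G x i * φ x) (vol l r) := (coord G i).integrable_mul hφ2
      have i2 : Integrable (fun x => G' x i * φ x) (vol l r) := (coord G' i).integrable_mul hφ2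
      rw [e, integral_sub i1 i2, e1, e2, sub_self])
    filter_upwards [key, hm.coeFn_toLp] with x h1 h2
    rw [h2, Pi.sub_apply, sub_eq_zero] at h1
    exact h1
  apply Lp.ext
  filter_upwards [main 0, main 1] with x h0 h1
  ext i
  fin_cases i
  · exact h0
  · exact h1

open Classical in
/-- The (weak) shallow water gradient `∇_sw q`, equal to `0` when it is not in `(L²(Ω))²`. -/
def gradSW {l r : ℝ} (H zb : ℝ → ℝ) (q : L2 l r) : L2Vec l r :=
  if h : ∃ G, HasWeakGrad H zb q G then h.choose else 0

open Classical in
/-- The (weak) shallow water divergence `div_sw v`, equal to `0` when it is not in `L²(Ω)`. -/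
def divSW {l r : ℝ} (H zb : ℝ → ℝ) (v : L2Vec l r) : L2 l r :=
  if h : ∃ g, HasWeakDiv H zb v g then h.choose else 0

theorem HasWeakGrad.gradSW_eq {l r : ℝ} {H zb : ℝ → ℝ} {q : L2 l r} {G : L2Vec l r}
    (h : HasWeakGrad H zb q G) : gradSW H zb q = G := by
  have hex : ∃ G, HasWeakGrad H zb q G := ⟨G, h⟩
  rw [gradSW, dif_pos hex]
  exact hex.choose_spec.unique h

theorem HasWeakDiv.divSW_eq {l r : ℝ} {H zb : ℝ → ℝ} {v : L2Vec l r} {g : L2 l r}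
    (h : HasWeakDiv H zb v g) : divSW H zb v = g := by
  have hex : ∃ g, HasWeakDiv H zb v g := ⟨g, h⟩
  rw [divSW, dif_pos hex]
  exact hex.choose_spec.unique h

/-- `f` has zero trace on `Γ = {l, r}`: it agrees almost everywhere on `Ω` with a function that is
continuous on `[l, r]` and vanishes at both end points. (If `v` and `div_sw v` are square
integrable and `H` is `C¹` and bounded below by a positive constant, then `v₁` always has a
representative continuous on `[l, r]`, so its boundary values make sense.) -/
def HasZeroTrace (l r : ℝ) (f : ℝ → ℝ) : Prop :=
  ∃ w : ℝ → ℝ, ContinuousOn w (Icc l r) ∧ f =ᵐ[vol l r] w ∧ w l = 0 ∧ w r = 0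

/-- `Q = {q ∈ L²(Ω) | ∇_sw q ∈ (L²(Ω))²}`. -/
def Q (l r : ℝ) (H zb : ℝ → ℝ) : Set (L2 l r) :=
  {q | ∃ G, HasWeakGrad H zb q G}

/-- `V₀ = {v ∈ (L²(Ω))² | div_sw v ∈ L²(Ω), v₁ = 0 on Γ}`. -/
def V0 (l r : ℝ) (H zb : ℝ → ℝ) : Set (L2Vec l r) :=
  {v | (∃ g, HasWeakDiv H zb v g) ∧ HasZeroTrace l r (fun x => v x 0)}

/-- `a(u, v) = ∫ H u · v`. -/
def formA {l r : ℝ} (H : ℝ → ℝ) (u v : L2Vec l r) : ℝ :=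
  ∫ x, H x * inner ℝ (u x) (v x) ∂(vol l r)

/-- `b(v, q) = - ∫ div_sw(v) q`. -/
def formB {l r : ℝ} (H zb : ℝ → ℝ) (v : L2Vec l r) (q : L2 l r) : ℝ :=
  -∫ x, divSW H zb v x * q x ∂(vol l r)

/-- `ker B = {v ∈ V₀ | b(v, q) = 0 for all q ∈ Q}`. -/
def kerB (l r : ℝ) (H zb : ℝ → ℝ) : Set (L2Vec l r) :=
  {v ∈ V0 l r H zb | ∀ q ∈ Q l r H zb, formB H zb v q = 0}

/-- `ker Bᵗ = {q ∈ Q | b(v, q) = 0 for all v ∈ V₀}`. -/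
def kerBt (l r : ℝ) (H zb : ℝ → ℝ) : Set (L2 l r) :=
  {q ∈ Q l r H zb | ∀ v ∈ V0 l r H zb, formB H zb v q = 0}

/-- The graph norm `(‖v‖² + ‖div_sw v‖²)^(1/2)` on `V₀`. -/
def graphNormV {l r : ℝ} (H zb : ℝ → ℝ) (v : L2Vec l r) : ℝ :=
  √(‖v‖ ^ 2 + ‖divSW H zb v‖ ^ 2)

/-- The graph norm `(‖q‖² + ‖∇_sw q‖²)^(1/2)` on `Q`. -/
def graphNormQ {l r : ℝ} (H zb : ℝ → ℝ) (q : L2 l r) : ℝ :=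
  √(‖q‖ ^ 2 + ‖gradSW H zb q‖ ^ 2)

/-- The Babuška–Brezzi (inf-sup) condition for `b` on `V₀ × Q`, where `V₀` carries the norm `nV`
and `Q` the norm `nQ`; the infimum and the supremum range over the nonzero elements. -/
def InfSup (l r : ℝ) (H zb : ℝ → ℝ) (nV : L2Vec l r → ℝ) (nQ : L2 l r → ℝ) : Prop :=
  ∃ γ : ℝ, 0 < γ ∧
    γ < ⨅ q : {q : L2 l r // q ∈ Q l r H zb ∧ q ≠ 0},
          ⨆ v : {v : L2Vec l r // v ∈ V0 l r H zb ∧ v ≠ 0},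
            formB H zb v.1 q.1 / (nV v.1 * nQ q.1)

/-- `(u, p) ∈ V₀ × Q` solves the mixed problem with time step `dt` and datum `u₀ = u^{n+1/2}`. -/
def IsMixedSolution {l r : ℝ} (H zb : ℝ → ℝ) (dt : ℝ) (u₀ : L2Vec l r)
    (u : L2Vec l r) (p : L2 l r) : Prop :=
  u ∈ V0 l r H zb ∧ p ∈ Q l r H zb ∧
    (∀ v ∈ V0 l r H zb, 1 / dt * formA H u v + formB H zb v p = 1 / dt * formA H u₀ v) ∧
    ∀ q ∈ Q l r H zb, formB H zb u q = 0

end ShallowWater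

end

noncomputable section

namespace ShallowWater

/-! The zeroth-order terms of the two operators replace a Poincaré inequality. The second component
of `∇_sw q` is `-2q`, so `2‖q‖ ≤ ‖∇_sw q‖`, and the gradient is injective. Dually, `div_sw (0, w) =
2w` with `(0, w) ∈ V₀` for every `w ∈ L²`, so the divergence maps `V₀` onto `L²`.

The weak operators are handled through absolutely continuous representatives `U` of `H v₁` and `P`
of `q`. Almost everywhere `q div_sw v + v · ∇_sw q = (U P)'`, and the zero trace makes `U` vanish at
both ends; hence `b(v, q) = ∫ ∇_sw q · v` on `V₀ × Q` (`integral_mul_eq_neg_inner`).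

For the first pair of norms, `V₀` is dense in `(L²)²` (`dense_V0`), so the supremum of `b(v, q)/‖v‖`
is `‖∇_sw q‖`, comparable to the graph norm of `q`. For the second pair, `v = (0, -q)` suffices.
Since `Q` contains the test functions, fields in `ker B` are divergence free, which yields
coercivity in the graph norm.

For existence, the momentum equation suggests `u = u₀ - dt H⁻¹ ∇_sw p`, and `u` must be orthogonal
to all gradients. The gradients form a closed subspace (`isClosed_gradRange`), so Lax–Milgram with
weight `H⁻¹` provides `∇_sw p`; orthogonality to gradients then yields both zero divergence and zero
trace (`hasWeakDiv_zero_of_inner_grad`). Uniqueness follows from coercivity for `u` and from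
vertical test fields for `p`. -/

/-- Absolute continuity on `[l, r]`. -/
abbrev AC (l r : ℝ) (f : ℝ → ℝ) : Prop := AbsolutelyContinuousOnInterval f l r

/-! ### Weak derivatives and absolutely continuous representatives on an interval -/

theorem integral_vol {l r : ℝ} (hlr : l < r) (f : ℝ → ℝ) :
    ∫ x, f x ∂(vol l r) = ∫ x in l..r, f x := by
  rw [intervalIntegral.integral_of_le hlr.le, integral_Ioc_eq_integral_Ioo]

theorem integrable_vol_iff {l r : ℝ} (hlr : l < r) {f : ℝ → ℝ} :
    Integrable f (vol l r) ↔ IntervalIntegrable f volume l r := by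
  rw [intervalIntegrable_iff_integrableOn_Ioc_of_le hlr.le, integrableOn_Ioc_iff_integrableOn_Ioo]
  rfl

theorem ae_vol_mem (l r : ℝ) : ∀ᵐ x ∂(vol l r), x ∈ Ioo l r :=
  ae_restrict_mem measurableSet_Ioo

theorem memLp_top_of_continuousOn {l r : ℝ} {f : ℝ → ℝ} (hf : ContinuousOn f (Icc l r)) :
    MemLp f ⊤ (vol l r) := by
  obtain ⟨C, hC⟩ := isCompact_Icc.exists_bound_of_continuousOn hf
  refine memLp_top_of_bound
    ((hf.mono Ioo_subset_Icc_self).aestronglyMeasurable measurableSet_Ioo) C ?_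
  filter_upwards [ae_vol_mem l r] with x hx using hC x (Ioo_subset_Icc_self hx)

theorem memLp_of_continuousOn {l r : ℝ} {f : ℝ → ℝ} (hf : ContinuousOn f (Icc l r)) :
    MemLp f 2 (vol l r) :=
  (memLp_top_of_continuousOn hf).mono_exponent le_top

/-- `derivWithin` is continuous on the compact interval and equals `deriv` in its interior; the
values of `deriv` at the end points do not matter. -/
theorem memLp_top_deriv {l r : ℝ} (hlr : l < r) {f : ℝ → ℝ} (hf : ContDiffOn ℝ 1 f (Icc l r)) :
    MemLp (deriv f) ⊤ (vol l r) := by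
  refine (memLp_top_of_continuousOn
    (hf.continuousOn_derivWithin (uniqueDiffOn_Icc hlr) le_rfl)).ae_eq ?_
  filter_upwards [ae_vol_mem l r] with x hx
    using derivWithin_of_mem_nhds (Icc_mem_nhds hx.1 hx.2)

theorem _root_.ContDiffOn.ac {l r : ℝ} (hlr : l < r) {f : ℝ → ℝ}
    (hf : ContDiffOn ℝ 1 f (Icc l r)) : AC l r f := by
  rw [← uIcc_of_le hlr.le] at hf
  exact hf.absolutelyContinuousOnInterval

theorem AC.continuousOn_Icc {l r : ℝ} (hlr : l < r) {f : ℝ → ℝ} (hf : AC l r f) :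
    ContinuousOn f (Icc l r) := by
  have := AbsolutelyContinuousOnInterval.continuousOn hf
  rwa [uIcc_of_le hlr.le] at this

theorem AC.ae_differentiableAt_vol {l r : ℝ} (hlr : l < r) {f : ℝ → ℝ} (hf : AC l r f) :
    ∀ᵐ x ∂(vol l r), DifferentiableAt ℝ f x := by
  filter_upwards [ae_restrict_of_ae (AbsolutelyContinuousOnInterval.ae_differentiableAt hf),
    ae_vol_mem l r] with x hx hm
  exact hx (by rw [uIcc_of_le hlr.le]; exact Ioo_subset_Icc_self hm)

theorem AC.integral_deriv_mul_add {l r : ℝ} (hlr : l < r) {f g : ℝ → ℝ} (hf : AC l r f)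
    (hg : AC l r g) :
    ∫ x, (deriv f x * g x + f x * deriv g x) ∂(vol l r) = f r * g r - f l * g l := by
  rw [integral_vol hlr]
  exact AbsolutelyContinuousOnInterval.integral_deriv_mul_eq_sub hf hg

theorem IsTest.ac {l r : ℝ} (hlr : l < r) {φ : ℝ → ℝ} (h : IsTest l r φ) : AC l r φ :=
  ContDiffOn.ac hlr ((h.1.of_le (by exact_mod_cast le_top)).contDiffOn)

theorem IsTest.eq_zero {E : Type*} [NormedAddCommGroup E] [NormedSpace ℝ E] {l r : ℝ}
    {φ : ℝ → E} (h : IsTest l r φ) {x : ℝ} (hx : x ∉ Ioo l r) : φ x = 0 := by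
  by_contra h0
  exact hx (h.2.2 (subset_tsupport φ h0))

theorem IsTest.memLp {E : Type*} [NormedAddCommGroup E] [NormedSpace ℝ E] {l r : ℝ}
    {φ : ℝ → E} (h : IsTest l r φ) : MemLp φ 2 (vol l r) :=
  h.1.continuous.memLp_of_hasCompactSupport h.2.1

theorem IsTest.isTest_deriv {l r : ℝ} {φ : ℝ → ℝ} (h : IsTest l r φ) : IsTest l r (deriv φ) :=
  ⟨((contDiff_infty_iff_deriv (f := φ)).1 h.1).2, h.2.1.deriv,
    (tsupport_deriv_subset (𝕜 := ℝ)).trans h.2.2⟩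

theorem exists_isTest_integral_eq_one {l r : ℝ} (hlr : l < r) :
    ∃ χ : ℝ → ℝ, IsTest l r χ ∧ ∫ x, χ x ∂(vol l r) = 1 := by
  let B : ContDiffBump ((l + r) / 2) := ⟨(r - l) / 8, (r - l) / 4, by linarith, by linarith⟩
  have hsub : tsupport (B.normed volume) ⊆ Ioo l r := by
    rw [B.tsupport_normed_eq, Real.closedBall_eq_Icc]
    intro x hx
    have h1 := hx.1
    have h2 := hx.2
    change (l + r) / 2 - (r - l) / 4 ≤ x at h1
    change x ≤ (l + r) / 2 + (r - l) / 4 at h2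
    constructor <;> linarith
  refine ⟨B.normed volume, ⟨B.contDiff_normed, B.hasCompactSupport_normed, hsub⟩, ?_⟩
  rw [setIntegral_eq_integral_of_forall_compl_eq_zero]
  · exact B.integral_normed
  · intro x hx
    by_contra h0
    exact hx (hsub (subset_tsupport _ h0))

/-- A test function with zero mean is the derivative of a test function. -/
theorem IsTest.exists_primitive {l r : ℝ} (hlr : l < r) {ψ : ℝ → ℝ} (h : IsTest l r ψ)
    (h0 : ∫ x, ψ x ∂(vol l r) = 0) : ∃ φ : ℝ → ℝ, IsTest l r φ ∧ ∀ x, deriv φ x = ψ x := by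
  have hc := h.1.continuous
  have hd : ∀ x, HasDerivAt (fun x => ∫ t in l..x, ψ t) (ψ x) x := fun x =>
    intervalIntegral.integral_hasDerivAt_right (hc.intervalIntegrable _ _)
      (hc.stronglyMeasurableAtFilter _ _) hc.continuousAt
  have hder : deriv (fun x => ∫ t in l..x, ψ t) = ψ := funext fun x => (hd x).deriv
  -- A compact subinterval of `Ω` carrying `ψ`: the primitive vanishes to its left because `ψ` does,
  -- and to its right because `ψ` has zero mean.
  obtain ⟨a, b, ha, hb, hs⟩ : ∃ a b, l < a ∧ b < r ∧ tsupport ψ ⊆ Icc a b := by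
    rcases (tsupport ψ).eq_empty_or_nonempty with he | hne
    · exact ⟨l + 1, r - 1, by linarith, by linarith, by simp [he]⟩
    · have hK : IsCompact (tsupport ψ) := h.2.1
      obtain ⟨a, ha, hal⟩ := hK.exists_isLeast hne
      obtain ⟨b, hb, hbl⟩ := hK.exists_isGreatest hne
      exact ⟨a, b, (h.2.2 ha).1, (h.2.2 hb).2, fun x hx => ⟨hal hx, hbl hx⟩⟩
  have hz : ∀ x, x ∉ Icc a b → ψ x = 0 := fun x hx => by
    by_contra hne
    exact hx (hs (subset_tsupport ψ hne))
  have hl : ∀ x, x < a → ∫ t in l..x, ψ t = 0 := fun x hx => by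
    refine (intervalIntegral.integral_congr (g := fun _ => (0 : ℝ)) fun t ht => ?_).trans (by simp)
    refine hz t fun hm => ?_
    have := ht.2
    have h2 : max l x < a := max_lt ha hx
    linarith [hm.1]
  have hr : ∀ x, b < x → ∫ t in l..x, ψ t = 0 := fun x hx => by
    rw [← intervalIntegral.integral_add_adjacent_intervals (hc.intervalIntegrable l r)
      (hc.intervalIntegrable r x), ← integral_vol hlr, h0, zero_add]
    refine (intervalIntegral.integral_congr (g := fun _ => (0 : ℝ)) fun t ht => ?_).trans (by simp)
    refine hz t fun hm => ?_
    have := ht.1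
    have h2 : b < min r x := lt_min hb hx
    linarith [hm.2]
  have hsupp : tsupport (fun x => ∫ t in l..x, ψ t) ⊆ Icc a b := by
    refine closure_minimal (fun x hx => ?_) isClosed_Icc
    by_contra hm
    rw [mem_Icc, not_and_or, not_le, not_le] at hm
    exact hx (hm.elim (hl x) (hr x))
  refine ⟨fun x => ∫ t in l..x, ψ t, ⟨?_, ?_, ?_⟩, fun x => (hd x).deriv⟩
  · rw [contDiff_infty_iff_deriv, hder]
    exact ⟨fun x => (hd x).differentiableAt, h.1⟩
  · exact isCompact_Icc.of_isClosed_subset (isClosed_tsupport _) hsupp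
  · exact hsupp.trans fun x hx => ⟨ha.trans_le hx.1, hx.2.trans_lt hb⟩

theorem ae_eq_zero_of_integral_mul_test {l r : ℝ} {f : ℝ → ℝ} (hf : MemLp f 2 (vol l r))
    (h : ∀ φ : ℝ → ℝ, IsTest l r φ → ∫ x, f x * φ x ∂(vol l r) = 0) :
    ∀ᵐ x ∂(vol l r), f x = 0 := by
  have key := ae_zero_of_test (hf.toLp f) fun φ hφ => by
    rw [← h φ hφ]
    apply integral_congr_ae
    filter_upwards [hf.coeFn_toLp] with x hx
    rw [hx]
  filter_upwards [key, hf.coeFn_toLp] with x h1 h2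
  rw [← h2, h1]

theorem integrable_mul_isTest {l r : ℝ} {f : ℝ → ℝ} (hf : MemLp f 2 (vol l r))
    {φ : ℝ → ℝ} (hφ : IsTest l r φ) : Integrable (fun x => f x * φ x) (vol l r) :=
  hf.integrable_mul hφ.memLp

theorem IsTest.integrable {l r : ℝ} {φ : ℝ → ℝ} (h : IsTest l r φ) : Integrable φ (vol l r) :=
  h.memLp.integrable (by norm_num)

/-- **Du Bois-Reymond lemma**: a function whose weak derivative vanishes is constant. -/
theorem exists_ae_eq_const_of_integral_mul_deriv {l r : ℝ} (hlr : l < r) {f : ℝ → ℝ}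
    (hf : MemLp f 2 (vol l r))
    (h : ∀ φ : ℝ → ℝ, IsTest l r φ → ∫ x, f x * deriv φ x ∂(vol l r) = 0) :
    ∃ c : ℝ, ∀ᵐ x ∂(vol l r), f x = c := by
  obtain ⟨χ, hχ, hχ1⟩ := exists_isTest_integral_eq_one hlr
  refine ⟨∫ x, f x * χ x ∂(vol l r), ?_⟩
  set c := ∫ x, f x * χ x ∂(vol l r) with hc
  -- Subtracting its mean times the bump `χ` turns `ψ` into the derivative of a test function, so `∫
  -- f ψ = (∫ f χ)(∫ ψ)`.
  have key := ae_eq_zero_of_integral_mul_test (hf.sub (memLp_const c)) fun ψ hψ => by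
    set m := ∫ x, ψ x ∂(vol l r) with hm
    have hts : IsTest l r (fun x => ψ x - m * χ x) := by
      refine ⟨hψ.1.sub (contDiff_const.mul hχ.1), ?_, ?_⟩
      · exact hψ.2.1.sub (hχ.2.1.mul_left (f := fun _ => m))
      · exact (tsupport_sub ψ (fun x => m * χ x)).trans
          (union_subset hψ.2.2 ((tsupport_mul_subset_right (f := fun _ => m)).trans hχ.2.2))
    obtain ⟨φ, hφ, hd⟩ := hts.exists_primitive hlr (by
      rw [integral_sub hψ.integrable (hχ.integrable.const_mul m), integral_const_mul, hχ1, ← hm]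
      ring)
    have h1 := h φ hφ
    simp only [hd] at h1
    have i1 := integrable_mul_isTest hf hψ
    have i2 := integrable_mul_isTest hf hχ
    have e1 : ∫ x, f x * (ψ x - m * χ x) ∂(vol l r) = (∫ x, f x * ψ x ∂(vol l r)) - m * c := by
      rw [hc, ← integral_const_mul, ← integral_sub i1 (i2.const_mul m)]
      congr 1 with x
      ring
    have e2 : ∫ x, (f - (fun _ => c : ℝ → ℝ)) x * ψ x ∂(vol l r)
        = (∫ x, f x * ψ x ∂(vol l r)) - c * m := by
      rw [hm, ← integral_const_mul, ← integral_sub i1 (hψ.integrable.const_mul c)]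
      congr 1 with x
      simp only [Pi.sub_apply]
      ring
    rw [e2, mul_comm c m, ← e1, h1]
  filter_upwards [key] with x hx using sub_eq_zero.1 hx

/-- A square integrable function with square integrable weak derivative has an absolutely
continuous representative. -/
theorem exists_ac_of_weak_deriv {l r : ℝ} (hlr : l < r) {f g : ℝ → ℝ} (hf : MemLp f 2 (vol l r))
    (hg : MemLp g 2 (vol l r))
    (h : ∀ φ : ℝ → ℝ, IsTest l r φ →
      ∫ x, f x * deriv φ x ∂(vol l r) = -∫ x, g x * φ x ∂(vol l r)) :
    ∃ F : ℝ → ℝ, AC l r F ∧ (∀ᵐ x ∂(vol l r), f x = F x) ∧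
      ∀ᵐ x ∂(vol l r), deriv F x = g x := by
  have hi : IntervalIntegrable g volume l r :=
    (integrable_vol_iff hlr).1 (hg.integrable (by norm_num))
  set P : ℝ → ℝ := fun x => ∫ t in l..x, g t with hP
  have hac : AC l r P := hi.absolutelyContinuousOnInterval_intervalIntegral left_mem_uIcc
  have hdP : ∀ᵐ x ∂(vol l r), HasDerivAt P (g x) x := by
    filter_upwards [ae_restrict_of_ae hi.ae_hasDerivAt_integral, ae_vol_mem l r] with x hx hm
    exact hx (by rw [uIcc_of_le hlr.le]; exact Ioo_subset_Icc_self hm) l left_mem_uIcc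
  have hPm : MemLp P 2 (vol l r) := memLp_of_continuousOn (hac.continuousOn_Icc hlr)
  -- `f` and the primitive `P` of `g` have the same weak derivative, so they differ by a constant.
  obtain ⟨c, hc⟩ := exists_ae_eq_const_of_integral_mul_deriv hlr (hf.sub hPm) fun φ hφ => by
    have h1 := hac.integral_deriv_mul_add hlr (hφ.ac hlr)
    rw [hφ.eq_zero (x := r) (by simp), hφ.eq_zero (x := l) (by simp)] at h1
    have i1 := integrable_mul_isTest hg hφ
    have i2 := integrable_mul_isTest hPm hφ.isTest_deriv
    have i3 := integrable_mul_isTest hf hφ.isTest_deriv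
    have e1 : ∫ x, (deriv P x * φ x + P x * deriv φ x) ∂(vol l r)
        = (∫ x, g x * φ x ∂(vol l r)) + ∫ x, P x * deriv φ x ∂(vol l r) := by
      rw [← integral_add i1 i2]
      apply integral_congr_ae
      filter_upwards [hdP] with x hx
      rw [hx.deriv]
    have e2 : ∫ x, (f - P) x * deriv φ x ∂(vol l r)
        = (∫ x, f x * deriv φ x ∂(vol l r)) - ∫ x, P x * deriv φ x ∂(vol l r) := by
      rw [← integral_sub i3 i2]
      congr 1 with x
      simp only [Pi.sub_apply]
      ring
    rw [e2, h φ hφ]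
    linarith
  refine ⟨fun x => P x + c, ?_, ?_, ?_⟩
  · exact AbsolutelyContinuousOnInterval.add hac
      (ContDiffOn.ac hlr (contDiffOn_const (c := c)))
  · filter_upwards [hc] with x hx
    simp only [Pi.sub_apply] at hx
    linarith
  · filter_upwards [hdP] with x hx using (hx.add_const c).deriv

/-! ### Weak shallow water operators and integration by parts -/

/-- The slope `∂ₓ(H + 2 z_b)` of the free surface and the topography. -/
def slope (H zb : ℝ → ℝ) : ℝ → ℝ := deriv fun y => H y + 2 * zb y

theorem memLp_top_slope {l r : ℝ} (hlr : l < r) {H zb : ℝ → ℝ} (hH : ContDiffOn ℝ 1 H (Icc l r))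
    (hzb : ContDiffOn ℝ 1 zb (Icc l r)) : MemLp (slope H zb) ⊤ (vol l r) :=
  memLp_top_deriv hlr (hH.add (contDiffOn_const.mul hzb))

theorem memLp_bdd_mul {l r : ℝ} {m f : ℝ → ℝ} (hm : MemLp m ⊤ (vol l r))
    (hf : MemLp f 2 (vol l r)) : MemLp (fun x => m x * f x) 2 (vol l r) :=
  MemLp.mul (r := 2) hf hm

theorem memLp_coord {l r : ℝ} (v : L2Vec l r) (i : Fin 2) :
    MemLp (fun x => v x i) 2 (vol l r) :=
  (Lp.memLp v).eval_piLp i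

theorem inner_plane (a b : Plane) : inner ℝ a b = a 0 * b 0 + a 1 * b 1 := by
  simp [PiLp.inner_apply, Fin.sum_univ_two, mul_comm]

section Weak

variable {l r : ℝ} {H zb : ℝ → ℝ}

/-- `div_sw v = g` says that `g + v₁ ∂ₓ(H + 2 z_b) - 2 v₂` is the weak derivative of `H v₁`. -/
theorem hasWeakDiv_iff_weak_deriv (hlr : l < r) (hH : ContDiffOn ℝ 1 H (Icc l r))
    (hzb : ContDiffOn ℝ 1 zb (Icc l r)) {v : L2Vec l r} {g : L2 l r} :
    HasWeakDiv H zb v g ↔ ∀ φ : ℝ → ℝ, IsTest l r φ →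
      ∫ x, (H x * v x 0) * deriv φ x ∂(vol l r)
        = -∫ x, (g x + slope H zb x * v x 0 - 2 * v x 1) * φ x ∂(vol l r) := by
  refine forall₂_congr fun φ hφ => ?_
  have m1 : MemLp (fun x => H x * v x 0) 2 (vol l r) :=
    memLp_bdd_mul (memLp_top_of_continuousOn hH.continuousOn) (memLp_coord v 0)
  have m2 : MemLp (fun x => slope H zb x * v x 0 - 2 * v x 1) 2 (vol l r) :=
    (memLp_bdd_mul (memLp_top_slope hlr hH hzb) (memLp_coord v 0)).sub
      ((memLp_coord v 1).const_mul 2)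
  have i1 := integrable_mul_isTest m1 hφ.isTest_deriv
  have i2 := integrable_mul_isTest m2 hφ
  have i3 := integrable_mul_isTest (Lp.memLp g) hφ
  have e1 : ∫ x, inner ℝ (v x) (smoothGrad H zb φ x) ∂(vol l r)
      = (∫ x, (H x * v x 0) * deriv φ x ∂(vol l r))
        + ∫ x, (slope H zb x * v x 0 - 2 * v x 1) * φ x ∂(vol l r) := by
    rw [← integral_add i1 i2]
    congr 1 with x
    simp only [inner_plane, smoothGrad, slope]
    simp
    ring
  have e2 : ∫ x, (g x + slope H zb x * v x 0 - 2 * v x 1) * φ x ∂(vol l r)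
      = (∫ x, g x * φ x ∂(vol l r))
        + ∫ x, (slope H zb x * v x 0 - 2 * v x 1) * φ x ∂(vol l r) := by
    rw [← integral_add i3 i2]
    congr 1 with x
    ring
  rw [e1, e2]
  constructor <;> intro h <;> linarith

/-- `U` is an absolutely continuous representative of `H v₁`, and `div_sw v = g`. -/
structure IsFlux (H zb : ℝ → ℝ) (v : L2Vec l r) (g : L2 l r) (U : ℝ → ℝ) : Prop where
  ac : AC l r U
  eq : ∀ᵐ x ∂(vol l r), H x * v x 0 = U x
  deriv_eq : ∀ᵐ x ∂(vol l r), deriv U x = g x + slope H zb x * v x 0 - 2 * v x 1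

theorem HasWeakDiv.exists_isFlux (hlr : l < r) (hH : ContDiffOn ℝ 1 H (Icc l r))
    (hzb : ContDiffOn ℝ 1 zb (Icc l r)) {v : L2Vec l r} {g : L2 l r} (h : HasWeakDiv H zb v g) :
    ∃ U, IsFlux H zb v g U := by
  rw [hasWeakDiv_iff_weak_deriv hlr hH hzb] at h
  obtain ⟨U, h1, h2, h3⟩ := exists_ac_of_weak_deriv hlr
    (memLp_bdd_mul (memLp_top_of_continuousOn hH.continuousOn) (memLp_coord v 0))
    (((Lp.memLp g).add (memLp_bdd_mul (memLp_top_slope hlr hH hzb) (memLp_coord v 0))).sub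
      ((memLp_coord v 1).const_mul 2)) h
  exact ⟨U, h1, h2, h3⟩

theorem IsFlux.hasWeakDiv (hlr : l < r) (hH : ContDiffOn ℝ 1 H (Icc l r))
    (hzb : ContDiffOn ℝ 1 zb (Icc l r)) {v : L2Vec l r} {g : L2 l r} {U : ℝ → ℝ}
    (h : IsFlux H zb v g U) : HasWeakDiv H zb v g := by
  rw [hasWeakDiv_iff_weak_deriv hlr hH hzb]
  intro φ hφ
  have m1 : MemLp (fun x => H x * v x 0) 2 (vol l r) :=
    memLp_bdd_mul (memLp_top_of_continuousOn hH.continuousOn) (memLp_coord v 0)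
  have m2 : MemLp (fun x => g x + slope H zb x * v x 0 - 2 * v x 1) 2 (vol l r) :=
    ((Lp.memLp g).add (memLp_bdd_mul (memLp_top_slope hlr hH hzb) (memLp_coord v 0))).sub
      ((memLp_coord v 1).const_mul 2)
  rw [eq_neg_iff_add_eq_zero, ← integral_add (integrable_mul_isTest m1 hφ.isTest_deriv)
    (integrable_mul_isTest m2 hφ)]
  have h1 := h.ac.integral_deriv_mul_add hlr (hφ.ac hlr)
  rw [hφ.eq_zero (x := r) (by simp), hφ.eq_zero (x := l) (by simp), mul_zero, mul_zero,
    sub_zero] at h1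
  rw [← h1]
  apply integral_congr_ae
  filter_upwards [h.eq, h.deriv_eq] with x h2 h3
  rw [h2, h3]
  ring

/-- `P` is an absolutely continuous representative of `q`, and `∇_sw q = G`. -/
structure IsPressure (H zb : ℝ → ℝ) (q : L2 l r) (G : L2Vec l r) (P : ℝ → ℝ) : Prop where
  ac : AC l r P
  eq : ∀ᵐ x ∂(vol l r), q x = P x
  fst_eq : ∀ᵐ x ∂(vol l r), G x 0 = H x * deriv P x + slope H zb x * P x
  snd_eq : ∀ᵐ x ∂(vol l r), G x 1 = -2 * q x

theorem IsTest.coord {Φ : ℝ → Plane} (h : IsTest l r Φ) (i : Fin 2) :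
    IsTest l r fun x => Φ x i := by
  refine ⟨(contDiff_euclidean.1 h.1) i, ?_, ?_⟩
  · exact h.2.1.comp_left (g := fun p : Plane => p i) rfl
  · exact (tsupport_comp_subset (g := fun p : Plane => p i) rfl Φ).trans h.2.2

theorem IsTest.single {φ : ℝ → ℝ} (h : IsTest l r φ) (i : Fin 2) :
    IsTest l r fun x => φ x • (EuclideanSpace.single i (1 : ℝ) : Plane) :=
  ⟨h.1.smul contDiff_const, h.2.1.smul_right, (tsupport_smul_subset_left φ _).trans h.2.2⟩

theorem deriv_mul_of_mem (hH : ContDiffOn ℝ 1 H (Icc l r)) {φ : ℝ → ℝ} (hφ : IsTest l r φ)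
    {x : ℝ} (hx : x ∈ Ioo l r) :
    deriv (fun y => H y * φ y) x = deriv H x * φ x + H x * deriv φ x := by
  have hd : DifferentiableAt ℝ H x :=
    (hH.differentiableOn one_ne_zero).differentiableAt (Icc_mem_nhds hx.1 hx.2)
  exact deriv_fun_mul hd (hφ.1.differentiable (by simp) x)

/-- Fields `(0, φ)` have divergence `2φ`, which involves no derivative of `φ`. -/
theorem HasWeakGrad.snd_eq {q : L2 l r} {G : L2Vec l r} (h : HasWeakGrad H zb q G) :
    ∀ᵐ x ∂(vol l r), G x 1 = -2 * q x := by
  have key := ae_eq_zero_of_integral_mul_test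
    ((memLp_coord G 1).add ((Lp.memLp q).const_mul 2)) fun φ hφ => by
      have h1 := h _ (hφ.single 1)
      have i1 := integrable_mul_isTest (memLp_coord G 1) hφ
      have i2 := integrable_mul_isTest ((Lp.memLp q).const_mul 2) hφ
      have e : ∀ x, ((fun x => G x 1) + fun x => 2 * q x) x * φ x
          = G x 1 * φ x + (2 * q x) * φ x := fun x => by simp [add_mul]
      simp only [e]
      rw [integral_add i1 i2, ← eq_neg_iff_add_eq_zero]
      calc ∫ x, G x 1 * φ x ∂(vol l r) = _ := by
            congr 1 with x
            simp [inner_plane]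
        _ = _ := h1
        _ = _ := by
            congr 2 with x
            simp [smoothDiv]
            ring
  filter_upwards [key] with x hx
  simp only [Pi.add_apply] at hx
  linarith

/-- Testing with `(φ, 0)` shows that `H q` has the weak derivative `G₁ + (H' - ∂ₓ(H + 2 z_b)) q`.
Its absolutely continuous representative is then divided by `H`, which is `C¹` and positive. -/
theorem HasWeakGrad.exists_isPressure (hlr : l < r) (hH : ContDiffOn ℝ 1 H (Icc l r))
    (hzb : ContDiffOn ℝ 1 zb (Icc l r)) (hpos : ∀ x ∈ Icc l r, 0 < H x) {q : L2 l r}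
    {G : L2Vec l r} (h : HasWeakGrad H zb q G) : ∃ P, IsPressure H zb q G P := by
  have m0 : MemLp (fun x => H x * q x) 2 (vol l r) :=
    memLp_bdd_mul (memLp_top_of_continuousOn hH.continuousOn) (Lp.memLp q)
  have m1 : MemLp (fun x => (deriv H x - slope H zb x) * q x) 2 (vol l r) :=
    memLp_bdd_mul ((memLp_top_deriv hlr hH).sub (memLp_top_slope hlr hH hzb)) (Lp.memLp q)
  have m2 : MemLp (fun x => G x 0 + (deriv H x - slope H zb x) * q x) 2 (vol l r) :=
    (memLp_coord G 0).add m1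
  obtain ⟨W, hW, hqW, hdW⟩ := exists_ac_of_weak_deriv hlr m0 m2 fun φ hφ => by
    have h1 := h _ (hφ.single 0)
    have i0 := integrable_mul_isTest m0 hφ.isTest_deriv
    have i1 := integrable_mul_isTest m1 hφ
    have i2 := integrable_mul_isTest (memLp_coord G 0) hφ
    have e1 : ∫ x, inner ℝ (G x) (φ x • (EuclideanSpace.single 0 (1 : ℝ) : Plane)) ∂(vol l r)
        = ∫ x, G x 0 * φ x ∂(vol l r) := by
      congr 1 with x
      simp [inner_plane]
    have e2 : ∫ x, q x * smoothDiv H zb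
          (fun x => φ x • (EuclideanSpace.single 0 (1 : ℝ) : Plane)) x ∂(vol l r)
        = (∫ x, (H x * q x) * deriv φ x ∂(vol l r))
          + ∫ x, ((deriv H x - slope H zb x) * q x) * φ x ∂(vol l r) := by
      rw [← integral_add i0 i1]
      apply integral_congr_ae
      filter_upwards [ae_vol_mem l r] with x hx
      simp [smoothDiv, deriv_mul_of_mem hH hφ hx, slope]
      ring
    have e3 : ∫ x, (G x 0 + (deriv H x - slope H zb x) * q x) * φ x ∂(vol l r)
        = (∫ x, G x 0 * φ x ∂(vol l r))
          + ∫ x, ((deriv H x - slope H zb x) * q x) * φ x ∂(vol l r) := by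
      rw [← integral_add i2 i1]
      congr 1 with x
      ring
    rw [e1, e2] at h1
    rw [e3]
    linarith
  have hinv : ContDiffOn ℝ 1 (fun x => (H x)⁻¹) (Icc l r) := hH.inv fun x hx => (hpos x hx).ne'
  refine ⟨fun x => W x * (H x)⁻¹, AbsolutelyContinuousOnInterval.fun_mul hW (hinv.ac hlr),
    ?_, ?_, h.snd_eq⟩
  · filter_upwards [hqW, ae_vol_mem l r] with x h1 hx
    have := (hpos x (Ioo_subset_Icc_self hx)).ne'
    rw [← h1]
    field_simp
  · filter_upwards [hqW, hdW, ae_vol_mem l r, hW.ae_differentiableAt_vol hlr] with x h1 h2 hx h3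
    have h0 := (hpos x (Ioo_subset_Icc_self hx)).ne'
    have hd : DifferentiableAt ℝ H x :=
      (hH.differentiableOn one_ne_zero).differentiableAt (Icc_mem_nhds hx.1 hx.2)
    rw [(h3.hasDerivAt.fun_mul (hd.hasDerivAt.fun_inv h0)).deriv, h2, ← h1]
    field_simp
    ring

theorem IsPressure.hasWeakGrad (hlr : l < r) (hH : ContDiffOn ℝ 1 H (Icc l r))
    {q : L2 l r} {G : L2Vec l r} {P : ℝ → ℝ} (h : IsPressure H zb q G P) :
    HasWeakGrad H zb q G := by
  intro Φ hΦ
  have hac : AC l r fun x => H x * Φ x 0 :=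
    AbsolutelyContinuousOnInterval.fun_mul (hH.ac hlr) ((hΦ.coord 0).ac hlr)
  have h1 := h.ac.integral_deriv_mul_add hlr hac
  have z : ∀ x, x ∉ Ioo l r → Φ x 0 = 0 := fun x hx => (hΦ.coord 0).eq_zero hx
  rw [z r (by simp), z l (by simp)] at h1
  have iX : Integrable (fun x => inner ℝ (G x) (Φ x)) (vol l r) := by
    simp only [inner_plane]
    exact (integrable_mul_isTest (memLp_coord G 0) (hΦ.coord 0)).add
      (integrable_mul_isTest (memLp_coord G 1) (hΦ.coord 1))
  have iZ : Integrable (fun x => deriv P x * (H x * Φ x 0)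
      + P x * deriv (fun x => H x * Φ x 0) x) (vol l r) := by
    rw [integrable_vol_iff hlr]
    exact ((AbsolutelyContinuousOnInterval.intervalIntegrable_deriv h.ac).mul_continuousOn
      hac.continuousOn).add ((AbsolutelyContinuousOnInterval.intervalIntegrable_deriv
        hac).continuousOn_mul h.ac.continuousOn)
  have e : ∫ x, q x * smoothDiv H zb Φ x ∂(vol l r)
      = ∫ x, ((deriv P x * (H x * Φ x 0) + P x * deriv (fun x => H x * Φ x 0) x)
        - inner ℝ (G x) (Φ x)) ∂(vol l r) := by
    apply integral_congr_ae
    filter_upwards [h.eq, h.fst_eq, h.snd_eq] with x h2 h3 h4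
    rw [inner_plane, h3, h4, h2, smoothDiv, slope]
    ring
  rw [e, integral_sub iZ iX, h1]
  ring

/-- Integration by parts for the shallow water operators, with boundary terms. -/
theorem IsFlux.integral_add (hlr : l < r) {v : L2Vec l r} {g : L2 l r} {U : ℝ → ℝ}
    (hU : IsFlux H zb v g U) {q : L2 l r} {G : L2Vec l r} {P : ℝ → ℝ}
    (hP : IsPressure H zb q G P) :
    (∫ x, g x * q x ∂(vol l r)) + ∫ x, inner ℝ (G x) (v x) ∂(vol l r)
      = U r * P r - U l * P l := by
  rw [← hU.ac.integral_deriv_mul_add hlr hP.ac,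
    ← MeasureTheory.integral_add (f := fun x => g x * q x)
      ((Lp.memLp g).integrable_mul (Lp.memLp q)) (L2.integrable_inner G v)]
  -- The product rule for `U P`: the slope terms and the terms in `v₂` cancel.
  apply integral_congr_ae
  filter_upwards [hU.eq, hU.deriv_eq, hP.eq, hP.fst_eq, hP.snd_eq] with x h1 h2 h3 h4 h5
  rw [inner_plane, h4, h5, h2, h3, ← h1]
  ring

theorem eqOn_Icc_of_ae_vol_eq (hlr : l < r) {f g : ℝ → ℝ} (hf : ContinuousOn f (Icc l r))
    (hg : ContinuousOn g (Icc l r)) (h : ∀ᵐ x ∂(vol l r), f x = g x) : EqOn f g (Icc l r) := by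
  refine Measure.eqOn_Icc_of_ae_eq volume hlr.ne ?_ hf hg
  rw [← restrict_Ioo_eq_restrict_Icc]
  exact h

/-- `U` and `H w` are continuous on `[l, r]` and agree almost everywhere, hence also at the end
points. -/
theorem HasZeroTrace.isFlux_eq_zero (hlr : l < r) (hH : ContDiffOn ℝ 1 H (Icc l r))
    {v : L2Vec l r} {g : L2 l r} {U : ℝ → ℝ} (ht : HasZeroTrace l r fun x => v x 0)
    (hU : IsFlux H zb v g U) : U l = 0 ∧ U r = 0 := by
  obtain ⟨w, hw, hvw, hl, hr⟩ := ht
  have key := eqOn_Icc_of_ae_vol_eq hlr (hU.ac.continuousOn_Icc hlr)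
    (hH.continuousOn.fun_mul hw) (by
    filter_upwards [hU.eq, hvw] with x h1 h2
    rw [← h1, h2])
  constructor
  · simp [key (left_mem_Icc.2 hlr.le), hl]
  · simp [key (right_mem_Icc.2 hlr.le), hr]

/-- Integration by parts on `V₀ × Q`. -/
theorem integral_mul_eq_neg_inner (hlr : l < r) (hH : ContDiffOn ℝ 1 H (Icc l r))
    (hzb : ContDiffOn ℝ 1 zb (Icc l r)) (hpos : ∀ x ∈ Icc l r, 0 < H x) {v : L2Vec l r}
    {g : L2 l r} (hv : HasWeakDiv H zb v g) (ht : HasZeroTrace l r fun x => v x 0) {q : L2 l r}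
    {G : L2Vec l r} (hq : HasWeakGrad H zb q G) :
    ∫ x, g x * q x ∂(vol l r) = -inner ℝ G v := by
  obtain ⟨U, hU⟩ := hv.exists_isFlux hlr hH hzb
  obtain ⟨P, hP⟩ := hq.exists_isPressure hlr hH hzb hpos
  obtain ⟨hl, hr⟩ := ht.isFlux_eq_zero hlr hH hU
  have := hU.integral_add hlr hP
  rw [hl, hr] at this
  rw [L2.inner_def]
  linarith

/-! ### Explicit elements of `V₀` and `Q` -/

/-- The vector field with the given components. -/
def mkVec {f g : ℝ → ℝ} (hf : MemLp f 2 (vol l r)) (hg : MemLp g 2 (vol l r)) : L2Vec l r :=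
  MemLp.toLp (fun x => !₂[f x, g x])
    (MemLp.of_eval_piLp fun i => by fin_cases i <;> simpa)

theorem mkVec_coord {f g : ℝ → ℝ} (hf : MemLp f 2 (vol l r)) (hg : MemLp g 2 (vol l r)) :
    ∀ᵐ x ∂(vol l r), mkVec hf hg x 0 = f x ∧ mkVec hf hg x 1 = g x := by
  filter_upwards [MemLp.coeFn_toLp (MemLp.of_eval_piLp (f := fun x => (!₂[f x, g x] : Plane))
    (p := 2) (μ := vol l r) fun i => by fin_cases i <;> simpa)] with x hx
  rw [mkVec, hx]
  simp

/-- The vector field `(0, w)`. -/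
def vertical (w : L2 l r) : L2Vec l r := mkVec (memLp_const 0) (Lp.memLp w)

theorem hasWeakDiv_vertical (hlr : l < r) (hH : ContDiffOn ℝ 1 H (Icc l r))
    (hzb : ContDiffOn ℝ 1 zb (Icc l r)) (w : L2 l r) :
    HasWeakDiv H zb (vertical w) ((2 : ℝ) • w) := by
  refine IsFlux.hasWeakDiv hlr hH hzb (U := fun _ => 0)
    ⟨ContDiffOn.ac hlr contDiffOn_const, ?_, ?_⟩
  · filter_upwards [mkVec_coord (memLp_const 0) (Lp.memLp w)] with x hx
    rw [vertical, hx.1, mul_zero]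
  · filter_upwards [mkVec_coord (memLp_const 0) (Lp.memLp w), Lp.coeFn_smul (2 : ℝ) w]
      with x hx h2
    rw [vertical, hx.1, hx.2, h2]
    simp

theorem hasZeroTrace_vertical (w : L2 l r) : HasZeroTrace l r fun x => vertical w x 0 := by
  refine ⟨fun _ => 0, continuousOn_const, ?_, rfl, rfl⟩
  filter_upwards [mkVec_coord (memLp_const 0) (Lp.memLp w)] with x hx using hx.1

theorem vertical_mem_V0 (hlr : l < r) (hH : ContDiffOn ℝ 1 H (Icc l r))
    (hzb : ContDiffOn ℝ 1 zb (Icc l r)) (w : L2 l r) : vertical w ∈ V0 l r H zb :=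
  ⟨⟨_, hasWeakDiv_vertical hlr hH hzb w⟩, hasZeroTrace_vertical w⟩

/-- For a test function `φ`, the vector field `(φ, 0)` belongs to `V₀`. -/
theorem horizontal_mem_V0 (hlr : l < r) (hH : ContDiffOn ℝ 1 H (Icc l r))
    (hzb : ContDiffOn ℝ 1 zb (Icc l r)) {φ : ℝ → ℝ} (hφ : IsTest l r φ) :
    mkVec hφ.memLp (memLp_const 0) ∈ V0 l r H zb := by
  have hc := mkVec_coord hφ.memLp (memLp_const (0 : ℝ))
  have m : MemLp (fun x => deriv H x * φ x + H x * deriv φ x - slope H zb x * φ x) 2 (vol l r) :=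
    ((memLp_bdd_mul (memLp_top_deriv hlr hH) hφ.memLp).add
      (memLp_bdd_mul (memLp_top_of_continuousOn hH.continuousOn) hφ.isTest_deriv.memLp)).sub
      (memLp_bdd_mul (memLp_top_slope hlr hH hzb) hφ.memLp)
  refine ⟨⟨m.toLp _, IsFlux.hasWeakDiv hlr hH hzb (U := fun x => H x * φ x)
    ⟨AbsolutelyContinuousOnInterval.fun_mul (hH.ac hlr) (hφ.ac hlr), ?_, ?_⟩⟩,
    φ, hφ.1.continuous.continuousOn, ?_, hφ.eq_zero (by simp), hφ.eq_zero (by simp)⟩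
  · filter_upwards [hc] with x hx
    rw [hx.1]
  · filter_upwards [hc, m.coeFn_toLp, ae_vol_mem l r] with x hx h2 h3
    rw [hx.1, hx.2, h2, deriv_mul_of_mem hH hφ h3]
    ring
  · filter_upwards [hc] with x hx using hx.1

/-- A `C¹` function on `[l, r]` belongs to `Q`. -/
theorem exists_isPressure_of_contDiffOn (hlr : l < r) (hH : ContDiffOn ℝ 1 H (Icc l r))
    (hzb : ContDiffOn ℝ 1 zb (Icc l r)) {P : ℝ → ℝ} (hP : ContDiffOn ℝ 1 P (Icc l r)) :
    ∃ (q : L2 l r) (G : L2Vec l r), IsPressure H zb q G P := by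
  have m0 := memLp_of_continuousOn hP.continuousOn
  have m1 : MemLp (fun x => H x * deriv P x + slope H zb x * P x) 2 (vol l r) :=
    (memLp_bdd_mul (memLp_top_of_continuousOn hH.continuousOn)
      ((memLp_top_deriv hlr hP).mono_exponent le_top)).add
      (memLp_bdd_mul (memLp_top_slope hlr hH hzb) m0)
  have m2 := m0.const_mul (-2)
  refine ⟨m0.toLp P, mkVec m1 m2, hP.ac hlr, m0.coeFn_toLp, ?_, ?_⟩
  · filter_upwards [mkVec_coord m1 m2] with x hx using hx.1
  · filter_upwards [mkVec_coord m1 m2, m0.coeFn_toLp] with x hx h2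
    rw [hx.2, h2]

end Weak

/-! ### The bilinear forms, the space `V₀` and its density -/

section Forms

variable {l r : ℝ} {H zb : ℝ → ℝ}

theorem L2.inner_eq_integral_mul (f g : L2 l r) : inner ℝ f g = ∫ x, f x * g x ∂(vol l r) := by
  rw [L2.inner_def]
  congr 1 with x
  simp [mul_comm]

/-- Multiplication of square integrable vector fields by a bounded function. -/
def mulL {m : ℝ → ℝ} (hm : MemLp m ⊤ (vol l r)) : L2Vec l r →L[ℝ] L2Vec l r :=
  (ContinuousLinearMap.lsmul ℝ ℝ).holderL (vol l r) ⊤ 2 2 (hm.toLp m)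

theorem mulL_apply {m : ℝ → ℝ} (hm : MemLp m ⊤ (vol l r)) (v : L2Vec l r) :
    ∀ᵐ x ∂(vol l r), mulL hm v x = m x • v x := by
  filter_upwards [(ContinuousLinearMap.lsmul ℝ ℝ : ℝ →L[ℝ] Plane →L[ℝ] Plane).coeFn_holder
    (r := 2) (hm.toLp m) v, hm.coeFn_toLp] with x h1 h2
  rw [h2] at h1
  exact h1

theorem inner_mulL {m : ℝ → ℝ} (hm : MemLp m ⊤ (vol l r)) (u v : L2Vec l r) :
    inner ℝ (mulL hm u) v = ∫ x, m x * inner ℝ (u x) (v x) ∂(vol l r) := by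
  rw [L2.inner_def]
  apply integral_congr_ae
  filter_upwards [mulL_apply hm u] with x hx
  rw [hx, real_inner_smul_left]

theorem mul_norm_sq_le_inner_mulL {m : ℝ → ℝ} (hm : MemLp m ⊤ (vol l r)) {c : ℝ}
    (hc : ∀ x ∈ Icc l r, c ≤ m x) (v : L2Vec l r) : c * ‖v‖ ^ 2 ≤ inner ℝ (mulL hm v) v := by
  rw [← real_inner_self_eq_norm_sq, ← real_inner_smul_left, L2.inner_def, L2.inner_def]
  refine integral_mono_ae (L2.integrable_inner _ _) (L2.integrable_inner _ _) ?_
  filter_upwards [mulL_apply hm v, Lp.coeFn_smul c v, ae_vol_mem l r] with x h1 h2 hx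
  rw [h1, h2, Pi.smul_apply, real_inner_smul_left, real_inner_smul_left]
  exact mul_le_mul_of_nonneg_right (hc x (Ioo_subset_Icc_self hx)) real_inner_self_nonneg

theorem HasWeakDiv.formB_eq {v : L2Vec l r} {g : L2 l r} (h : HasWeakDiv H zb v g) (q : L2 l r) :
    formB H zb v q = -inner ℝ g q := by
  rw [formB, h.divSW_eq, L2.inner_eq_integral_mul]

theorem HasWeakDiv.add (hlr : l < r) (hH : ContDiffOn ℝ 1 H (Icc l r))
    (hzb : ContDiffOn ℝ 1 zb (Icc l r)) {v v' : L2Vec l r} {g g' : L2 l r}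
    (h : HasWeakDiv H zb v g) (h' : HasWeakDiv H zb v' g') :
    HasWeakDiv H zb (v + v') (g + g') := by
  obtain ⟨U, hU⟩ := h.exists_isFlux hlr hH hzb
  obtain ⟨U', hU'⟩ := h'.exists_isFlux hlr hH hzb
  refine IsFlux.hasWeakDiv hlr hH hzb (U := fun x => U x + U' x)
    ⟨AbsolutelyContinuousOnInterval.fun_add hU.ac hU'.ac, ?_, ?_⟩
  · filter_upwards [hU.eq, hU'.eq, Lp.coeFn_add v v'] with x h1 h2 h3
    rw [← h1, ← h2, h3]
    simp [mul_add]
  · filter_upwards [hU.deriv_eq, hU'.deriv_eq, Lp.coeFn_add v v', Lp.coeFn_add g g',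
      hU.ac.ae_differentiableAt_vol hlr, hU'.ac.ae_differentiableAt_vol hlr] with x h1 h2 h3 h4 d d'
    rw [deriv_fun_add d d', h1, h2, h3, h4]
    simp
    ring

theorem HasWeakDiv.smul (hlr : l < r) (hH : ContDiffOn ℝ 1 H (Icc l r))
    (hzb : ContDiffOn ℝ 1 zb (Icc l r)) (c : ℝ) {v : L2Vec l r} {g : L2 l r}
    (h : HasWeakDiv H zb v g) : HasWeakDiv H zb (c • v) (c • g) := by
  obtain ⟨U, hU⟩ := h.exists_isFlux hlr hH hzb
  refine IsFlux.hasWeakDiv hlr hH hzb (U := fun x => c * U x)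
    ⟨AbsolutelyContinuousOnInterval.const_mul c hU.ac, ?_, ?_⟩
  · filter_upwards [hU.eq, Lp.coeFn_smul c v] with x h1 h3
    rw [← h1, h3]
    simp
    ring
  · filter_upwards [hU.deriv_eq, Lp.coeFn_smul c v, Lp.coeFn_smul c g] with x h1 h3 h4
    rw [deriv_const_mul_field, h1, h3, h4]
    simp
    ring

/-- `V₀` as a linear subspace. -/
def V0Submodule (hlr : l < r) (hH : ContDiffOn ℝ 1 H (Icc l r))
    (hzb : ContDiffOn ℝ 1 zb (Icc l r)) : Submodule ℝ (L2Vec l r) where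
  carrier := V0 l r H zb
  zero_mem' := by
    refine ⟨⟨0, IsFlux.hasWeakDiv hlr hH hzb (U := fun _ => 0)
      ⟨ContDiffOn.ac hlr contDiffOn_const, ?_, ?_⟩⟩, fun _ => 0, continuousOn_const, ?_, rfl, rfl⟩
    all_goals
      filter_upwards [Lp.coeFn_zero Plane 2 (vol l r), Lp.coeFn_zero ℝ 2 (vol l r)] with x h1 h2
      simp only [h1, h2, Pi.zero_apply, PiLp.zero_apply, mul_zero, add_zero, sub_zero, deriv_const]
  add_mem' := by
    rintro v v' ⟨⟨g, hg⟩, w, hw, hvw, hl, hr⟩ ⟨⟨g', hg'⟩, w', hw', hvw', hl', hr'⟩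
    refine ⟨⟨g + g', hg.add hlr hH hzb hg'⟩, fun x => w x + w' x, hw.add hw', ?_,
      by simp [hl, hl'], by simp [hr, hr']⟩
    filter_upwards [hvw, hvw', Lp.coeFn_add v v'] with x h1 h2 h3
    rw [h3, ← h1, ← h2]
    simp
  smul_mem' := by
    rintro c v ⟨⟨g, hg⟩, w, hw, hvw, hl, hr⟩
    refine ⟨⟨c • g, hg.smul hlr hH hzb c⟩, fun x => c * w x, continuousOn_const.mul hw, ?_,
      by simp [hl], by simp [hr]⟩
    filter_upwards [hvw, Lp.coeFn_smul c v] with x h1 h3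
    rw [h3, ← h1]
    simp

/-- A field orthogonal to all `(φ, 0)` and `(0, φ)` with `φ` a test function is zero. -/
theorem dense_V0 (hlr : l < r) (hH : ContDiffOn ℝ 1 H (Icc l r))
    (hzb : ContDiffOn ℝ 1 zb (Icc l r)) : Dense (V0 l r H zb) := by
  change Dense (V0Submodule hlr hH hzb : Set (L2Vec l r))
  rw [Submodule.dense_iff_topologicalClosure_eq_top, Submodule.topologicalClosure_eq_top_iff,
    Submodule.eq_bot_iff]
  intro G hG
  rw [Submodule.mem_orthogonal] at hG
  have h0 := ae_eq_zero_of_integral_mul_test (memLp_coord G 0) fun φ hφ => by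
    rw [← hG _ (horizontal_mem_V0 hlr hH hzb hφ), L2.inner_def]
    apply integral_congr_ae
    filter_upwards [mkVec_coord hφ.memLp (memLp_const (0 : ℝ))] with x hx
    rw [inner_plane, hx.1, hx.2]
    ring
  have h1 := ae_eq_zero_of_integral_mul_test (memLp_coord G 1) fun φ hφ => by
    rw [← hG _ (vertical_mem_V0 hlr hH hzb (hφ.memLp.toLp φ)), L2.inner_def]
    apply integral_congr_ae
    filter_upwards [mkVec_coord (memLp_const (0 : ℝ)) (Lp.memLp (hφ.memLp.toLp φ)),
      hφ.memLp.coeFn_toLp] with x hx h2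
    rw [inner_plane, vertical, hx.1, hx.2, h2]
    ring
  apply Lp.ext
  filter_upwards [h0, h1, Lp.coeFn_zero Plane 2 (vol l r)] with x h0 h1 h2
  rw [h2]
  ext i
  fin_cases i
  · exact h0
  · exact h1

/-- `Q` is dense: a divergence orthogonal to `Q` vanishes. -/
theorem HasWeakDiv.eq_zero_of_formB_eq_zero (hlr : l < r) (hH : ContDiffOn ℝ 1 H (Icc l r))
    (hzb : ContDiffOn ℝ 1 zb (Icc l r)) {v : L2Vec l r} {g : L2 l r} (h : HasWeakDiv H zb v g)
    (h0 : ∀ q ∈ Q l r H zb, formB H zb v q = 0) : g = 0 := by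
  have key := ae_zero_of_test g fun φ hφ => by
    -- Test functions are `C¹`, so they belong to `Q`.
    obtain ⟨q, G, hP⟩ := exists_isPressure_of_contDiffOn hlr hH hzb
      ((hφ.1.of_le (by exact_mod_cast le_top)).contDiffOn : ContDiffOn ℝ 1 φ (Icc l r))
    have h1 := h0 q ⟨G, hP.hasWeakGrad hlr hH⟩
    rw [h.formB_eq, neg_eq_zero, L2.inner_eq_integral_mul] at h1
    rw [← h1]
    apply integral_congr_ae
    filter_upwards [hP.eq] with x hx
    rw [hx]
  apply Lp.ext
  filter_upwards [key, Lp.coeFn_zero ℝ 2 (vol l r)] with x h1 h2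
  rw [h1, h2, Pi.zero_apply]

theorem formB_eq_inner_gradSW (hlr : l < r) (hH : ContDiffOn ℝ 1 H (Icc l r))
    (hzb : ContDiffOn ℝ 1 zb (Icc l r)) (hpos : ∀ x ∈ Icc l r, 0 < H x) {v : L2Vec l r}
    (hv : v ∈ V0 l r H zb) {q : L2 l r} (hq : q ∈ Q l r H zb) :
    formB H zb v q = inner ℝ (gradSW H zb q) v := by
  obtain ⟨⟨g, hg⟩, ht⟩ := hv
  obtain ⟨G, hG⟩ := hq
  rw [hg.formB_eq, hG.gradSW_eq, L2.inner_eq_integral_mul,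
    integral_mul_eq_neg_inner hlr hH hzb hpos hg ht hG, neg_neg]

/-- Since `w` is arbitrary in `L²`, this identity detects any pressure; it gives the trivial kernel
and the uniqueness of `p`. -/
theorem formB_vertical (hlr : l < r) (hH : ContDiffOn ℝ 1 H (Icc l r))
    (hzb : ContDiffOn ℝ 1 zb (Icc l r)) (w q : L2 l r) :
    formB H zb (vertical w) q = -2 * inner ℝ w q := by
  rw [(hasWeakDiv_vertical hlr hH hzb w).formB_eq, real_inner_smul_left]
  ring

/-! ### The two inf-sup conditions -/

theorem norm_vertical_le (w : L2 l r) : ‖vertical w‖ ≤ ‖w‖ := by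
  refine Lp.norm_le_norm_of_ae_le ?_
  filter_upwards [mkVec_coord (memLp_const (0 : ℝ)) (Lp.memLp w)] with x hx
  rw [EuclideanSpace.norm_eq, Fin.sum_univ_two, vertical, hx.1, hx.2]
  simp [Real.sqrt_sq_eq_abs]

theorem HasWeakGrad.two_mul_norm_le {q : L2 l r} {G : L2Vec l r} (h : HasWeakGrad H zb q G) :
    2 * ‖q‖ ≤ ‖G‖ := by
  have : ‖(2 : ℝ) • q‖ ≤ ‖G‖ := by
    refine Lp.norm_le_norm_of_ae_le ?_
    filter_upwards [h.snd_eq, Lp.coeFn_smul (2 : ℝ) q] with x h1 h2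
    refine le_trans (le_of_eq ?_) (PiLp.norm_apply_le (G x) 1)
    rw [h1, h2]
    simp
  rwa [norm_smul, Real.norm_two] at this

theorem formB_le (v : L2Vec l r) (q : L2 l r) : formB H zb v q ≤ ‖divSW H zb v‖ * ‖q‖ := by
  rw [formB, ← L2.inner_eq_integral_mul]
  exact (neg_le_abs _).trans (abs_real_inner_le_norm _ _)

/-- A real infimum over an empty index type is `0` by default, which would defeat the inf-sup bound.
-/
theorem exists_ne_zero_mem_Q (hlr : l < r) (hH : ContDiffOn ℝ 1 H (Icc l r))
    (hzb : ContDiffOn ℝ 1 zb (Icc l r)) : Nonempty {q : L2 l r // q ∈ Q l r H zb ∧ q ≠ 0} := by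
  obtain ⟨q, G, hP⟩ := exists_isPressure_of_contDiffOn hlr hH hzb
    (contDiffOn_const (c := (1 : ℝ)))
  refine ⟨q, ⟨G, hP.hasWeakGrad hlr hH⟩, ?_⟩
  rintro rfl
  have h1 : ∫ x, (1 : ℝ) ∂(vol l r) = 0 := by
    rw [← integral_zero ℝ ℝ (μ := vol l r)]
    apply integral_congr_ae
    filter_upwards [hP.eq, Lp.coeFn_zero ℝ 2 (vol l r)] with x h1 h2
    rw [← h1, h2, Pi.zero_apply]
  rw [integral_vol hlr] at h1
  simp at h1
  linarith

theorem infSup_norm_graphNormQ (hlr : l < r) (hH : ContDiffOn ℝ 1 H (Icc l r))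
    (hzb : ContDiffOn ℝ 1 zb (Icc l r)) (hpos : ∀ x ∈ Icc l r, 0 < H x) :
    InfSup l r H zb (fun v => ‖v‖) (graphNormQ H zb) := by
  have := exists_ne_zero_mem_Q hlr hH hzb
  -- The bound `1/2` is proved for each `q`; a smaller `γ` gives the strict inequality.
  refine ⟨1 / 4, by norm_num, lt_of_lt_of_le (by norm_num : (1 / 4 : ℝ) < 1 / 2) (le_ciInf ?_)⟩
  rintro ⟨q, hq, hq0⟩
  obtain ⟨G, hG⟩ := hq
  have hn : 0 < ‖q‖ := norm_pos_iff.2 hq0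
  have h2 := hG.two_mul_norm_le
  have hN : 0 < graphNormQ H zb q := Real.sqrt_pos.2 (by positivity)
  have hN1 : ‖G‖ ≤ graphNormQ H zb q := by
    rw [graphNormQ, hG.gradSW_eq]
    exact Real.le_sqrt_of_sq_le (by nlinarith)
  -- From `2‖q‖ ≤ ‖G‖`, the squared graph norm is at most `(5/4)‖G‖²`.
  have hN2 : graphNormQ H zb q ≤ 2 * ‖G‖ := by
    rw [graphNormQ, hG.gradSW_eq]
    exact Real.sqrt_le_iff.2 ⟨by positivity, by nlinarith⟩
  set s := ⨆ v : {v : L2Vec l r // v ∈ V0 l r H zb ∧ v ≠ 0},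
    formB H zb v.1 q / (‖v.1‖ * graphNormQ H zb q) with hs
  -- Boundedness is needed because an unbounded real supremum is `0` by default.
  have hbdd : BddAbove (range fun v : {v : L2Vec l r // v ∈ V0 l r H zb ∧ v ≠ 0} =>
      formB H zb v.1 q / (‖v.1‖ * graphNormQ H zb q)) := by
    refine ⟨1, ?_⟩
    rintro _ ⟨v, rfl⟩
    refine div_le_one_of_le₀ ?_ (by positivity)
    rw [formB_eq_inner_gradSW hlr hH hzb hpos v.2.1 ⟨G, hG⟩, hG.gradSW_eq, mul_comm]
    exact (real_inner_le_norm _ _).trans (mul_le_mul_of_nonneg_right hN1 (norm_nonneg _))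
  have hV : ∀ v ∈ V0 l r H zb, inner ℝ G v ≤ s * graphNormQ H zb q * ‖v‖ := by
    intro v hv
    rcases eq_or_ne v 0 with rfl | hv0
    · simp
    · have h1 := le_ciSup hbdd ⟨v, hv, hv0⟩
      rw [← hs] at h1
      have hv1 : 0 < ‖v‖ := norm_pos_iff.2 hv0
      rw [div_le_iff₀ (by positivity), formB_eq_inner_gradSW hlr hH hzb hpos hv ⟨G, hG⟩,
        hG.gradSW_eq] at h1
      linarith
  -- `G` need not lie in `V₀`; by density and continuity the inequality still extends to `v = G`.
  have hcl : IsClosed {v : L2Vec l r | inner ℝ G v ≤ s * graphNormQ H zb q * ‖v‖} :=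
    isClosed_le (by fun_prop) (by fun_prop)
  have hall : inner ℝ G G ≤ s * graphNormQ H zb q * ‖G‖ :=
    (dense_V0 hlr hH hzb).induction (P := fun v => inner ℝ G v ≤ s * graphNormQ H zb q * ‖v‖)
      hV hcl G
  rw [real_inner_self_eq_norm_sq] at hall
  have hG0 : 0 < ‖G‖ := by linarith
  have h3 : ‖G‖ ≤ s * graphNormQ H zb q := by
    by_contra hlt
    nlinarith
  have h4 : graphNormQ H zb q * (1 / 2) ≤ graphNormQ H zb q * s := by linarith
  exact le_of_mul_le_mul_left h4 hN

theorem infSup_graphNormV_norm (hlr : l < r) (hH : ContDiffOn ℝ 1 H (Icc l r))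
    (hzb : ContDiffOn ℝ 1 zb (Icc l r)) :
    InfSup l r H zb (graphNormV H zb) (fun q => ‖q‖) := by
  have := exists_ne_zero_mem_Q hlr hH hzb
  refine ⟨1 / 2, by norm_num, lt_of_lt_of_le (by norm_num : (1 / 2 : ℝ) < 2 / 3) (le_ciInf ?_)⟩
  rintro ⟨q, hq, hq0⟩
  have hn : 0 < ‖q‖ := norm_pos_iff.2 hq0
  have hbdd : BddAbove (range fun v : {v : L2Vec l r // v ∈ V0 l r H zb ∧ v ≠ 0} =>
      formB H zb v.1 q / (graphNormV H zb v.1 * ‖q‖)) := by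
    refine ⟨1, ?_⟩
    rintro _ ⟨v, rfl⟩
    refine div_le_one_of_le₀ ?_ (mul_nonneg (Real.sqrt_nonneg _) (norm_nonneg _))
    refine (formB_le _ _).trans (mul_le_mul_of_nonneg_right ?_ (norm_nonneg _))
    exact Real.le_sqrt_of_sq_le (le_add_of_nonneg_left (sq_nonneg _))
  have hd := hasWeakDiv_vertical hlr hH hzb (-q)
  have hb : formB H zb (vertical (-q)) q = 2 * ‖q‖ ^ 2 := by
    rw [formB_vertical hlr hH hzb, inner_neg_left, real_inner_self_eq_norm_sq]
    ring
  have hv0 : vertical (-q) ≠ 0 := by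
    intro h0
    have h1 := formB_le (H := H) (zb := zb) (vertical (-q)) q
    -- If the field were zero, it would equal `0` times itself and have divergence `0`,
    -- contradicting `b = 2‖q‖² > 0`.
    have h2 : HasWeakDiv H zb (vertical (-q)) ((0 : ℝ) • ((2 : ℝ) • -q)) := by
      have := hd.smul hlr hH hzb 0
      rwa [h0, smul_zero, ← h0] at this
    rw [hb, h2.divSW_eq, zero_smul, norm_zero, zero_mul] at h1
    nlinarith
  refine le_ciSup_of_le hbdd ⟨vertical (-q), vertical_mem_V0 hlr hH hzb _, hv0⟩ ?_
  have hd2 : ‖divSW H zb (vertical (-q))‖ = 2 * ‖q‖ := by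
    rw [hd.divSW_eq, norm_smul, norm_neg, Real.norm_two]
  have hv1 := norm_vertical_le (-q)
  rw [norm_neg] at hv1
  -- The squared graph norm is at most `5‖q‖² ≤ 9‖q‖²`; with `b = 2‖q‖²` this produces the ratio
  -- `2/3`.
  have hN : graphNormV H zb (vertical (-q)) ≤ 3 * ‖q‖ := by
    rw [graphNormV, hd2]
    refine Real.sqrt_le_iff.2 ⟨by positivity, ?_⟩
    nlinarith [norm_nonneg (vertical (-q))]
  have hN0 : 0 < graphNormV H zb (vertical (-q)) := by
    rw [graphNormV, hd2]
    exact Real.sqrt_pos.2 (by positivity)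
  change 2 / 3 ≤ formB H zb (vertical (-q)) q / (graphNormV H zb (vertical (-q)) * ‖q‖)
  rw [hb, le_div_iff₀ (by positivity)]
  nlinarith

end Forms

/-! ### Existence and uniqueness for the mixed problem -/

section WellPosed

variable {l r : ℝ} {H zb : ℝ → ℝ}

theorem memLp_smoothDiv (hlr : l < r) (hH : ContDiffOn ℝ 1 H (Icc l r))
    (hzb : ContDiffOn ℝ 1 zb (Icc l r)) {Φ : ℝ → Plane} (hΦ : IsTest l r Φ) :
    MemLp (smoothDiv H zb Φ) 2 (vol l r) := by
  have hc : ContDiffOn ℝ 1 (fun x => H x * Φ x 0) (Icc l r) :=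
    hH.mul (((hΦ.coord 0).1.of_le (by exact_mod_cast le_top)).contDiffOn)
  have h1 := (((memLp_top_deriv hlr hc).mono_exponent (p := 2) le_top).sub
    (memLp_bdd_mul (memLp_top_slope hlr hH hzb) (hΦ.coord 0).memLp)).add
    ((hΦ.coord 1).memLp.const_mul 2)
  refine h1.ae_eq (Filter.Eventually.of_forall fun x => ?_)
  simp only [Pi.add_apply, Pi.sub_apply, smoothDiv, slope]
  ring

/-- The vector field `(Φ₁, Φ₂ - div_sw Φ / 2)`; the fields orthogonal to these are the
shallow water gradients. -/
def testVec (hlr : l < r) (hH : ContDiffOn ℝ 1 H (Icc l r)) (hzb : ContDiffOn ℝ 1 zb (Icc l r))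
    {Φ : ℝ → Plane} (hΦ : IsTest l r Φ) : L2Vec l r :=
  mkVec (hΦ.coord 0).memLp
    ((hΦ.coord 1).memLp.sub ((memLp_smoothDiv hlr hH hzb hΦ).const_mul 2⁻¹))

/-- Substituting `q = -G₂/2` eliminates `q`, so being a gradient becomes a family of continuous
linear conditions on `G` alone. -/
theorem hasWeakGrad_iff_inner_testVec (hlr : l < r) (hH : ContDiffOn ℝ 1 H (Icc l r))
    (hzb : ContDiffOn ℝ 1 zb (Icc l r)) {q : L2 l r} {G : L2Vec l r}
    (h : ∀ᵐ x ∂(vol l r), G x 1 = -2 * q x) :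
    HasWeakGrad H zb q G ↔
      ∀ (Φ : ℝ → Plane) (hΦ : IsTest l r Φ), inner ℝ (testVec hlr hH hzb hΦ) G = 0 := by
  refine forall₂_congr fun Φ hΦ => ?_
  have i1 : Integrable (fun x => inner ℝ (G x) (Φ x)) (vol l r) := by
    simp only [inner_plane]
    exact (integrable_mul_isTest (memLp_coord G 0) (hΦ.coord 0)).add
      (integrable_mul_isTest (memLp_coord G 1) (hΦ.coord 1))
  have i2 : Integrable (fun x => q x * smoothDiv H zb Φ x) (vol l r) :=
    (Lp.memLp q).integrable_mul (memLp_smoothDiv hlr hH hzb hΦ)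
  have e : inner ℝ (testVec hlr hH hzb hΦ) G = (∫ x, inner ℝ (G x) (Φ x) ∂(vol l r))
      + ∫ x, q x * smoothDiv H zb Φ x ∂(vol l r) := by
    rw [L2.inner_def, ← integral_add i1 i2]
    apply integral_congr_ae
    filter_upwards [h, mkVec_coord (hΦ.coord 0).memLp
      ((hΦ.coord 1).memLp.sub ((memLp_smoothDiv hlr hH hzb hΦ).const_mul 2⁻¹))] with x h1 h2
    rw [inner_plane, inner_plane, testVec, h2.1, h2.2, h1]
    simp only [Pi.sub_apply]
    ring
  rw [e, eq_neg_iff_add_eq_zero]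

/-- The space of shallow water gradients. -/
def gradRange (hlr : l < r) (hH : ContDiffOn ℝ 1 H (Icc l r))
    (hzb : ContDiffOn ℝ 1 zb (Icc l r)) : Submodule ℝ (L2Vec l r) :=
  ⨅ Φ : {Φ : ℝ → Plane // IsTest l r Φ}, (innerSL ℝ (testVec hlr hH hzb Φ.2)).ker

/-- Closedness makes the space of gradients complete, as Lax–Milgram requires. -/
theorem isClosed_gradRange (hlr : l < r) (hH : ContDiffOn ℝ 1 H (Icc l r))
    (hzb : ContDiffOn ℝ 1 zb (Icc l r)) :
    IsClosed (gradRange hlr hH hzb : Set (L2Vec l r)) := by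
  rw [gradRange, Submodule.coe_iInf]
  exact isClosed_iInter fun Φ => ContinuousLinearMap.isClosed_ker _

theorem mem_gradRange_iff (hlr : l < r) (hH : ContDiffOn ℝ 1 H (Icc l r))
    (hzb : ContDiffOn ℝ 1 zb (Icc l r)) {G : L2Vec l r} :
    G ∈ gradRange hlr hH hzb ↔ ∃ q, HasWeakGrad H zb q G := by
  have hmem : G ∈ gradRange hlr hH hzb ↔
      ∀ (Φ : ℝ → Plane) (hΦ : IsTest l r Φ), inner ℝ (testVec hlr hH hzb hΦ) G = 0 := by
    simp [gradRange, Submodule.mem_iInf]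
  rw [hmem]
  constructor
  · intro h
    have m := (memLp_coord G 1).const_mul (-2⁻¹)
    refine ⟨m.toLp _, (hasWeakGrad_iff_inner_testVec hlr hH hzb ?_).2 h⟩
    filter_upwards [m.coeFn_toLp] with x hx
    rw [hx]
    ring
  · rintro ⟨q, hq⟩
    exact (hasWeakGrad_iff_inner_testVec hlr hH hzb hq.snd_eq).1 hq

/-- A vector field orthogonal to all gradients is divergence free with zero normal trace. -/
theorem hasWeakDiv_zero_of_inner_grad (hlr : l < r) (hH : ContDiffOn ℝ 1 H (Icc l r))
    (hzb : ContDiffOn ℝ 1 zb (Icc l r)) (hpos : ∀ x ∈ Icc l r, 0 < H x) {u : L2Vec l r}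
    (h : ∀ q G, HasWeakGrad H zb q G → inner ℝ G u = 0) :
    HasWeakDiv H zb u 0 ∧ HasZeroTrace l r fun x => u x 0 := by
  have hdiv : HasWeakDiv H zb u 0 := by
    intro φ hφ
    obtain ⟨q, G, hP⟩ := exists_isPressure_of_contDiffOn hlr hH hzb
      ((hφ.1.of_le (by exact_mod_cast le_top)).contDiffOn : ContDiffOn ℝ 1 φ (Icc l r))
    have h1 := h q G (hP.hasWeakGrad hlr hH)
    have e1 : ∫ x, (0 : L2 l r) x * φ x ∂(vol l r) = 0 := by
      rw [← integral_zero ℝ ℝ (μ := vol l r)]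
      apply integral_congr_ae
      filter_upwards [Lp.coeFn_zero ℝ 2 (vol l r)] with x hx
      rw [hx, Pi.zero_apply, zero_mul]
    rw [e1, zero_eq_neg, ← h1, L2.inner_def]
    apply integral_congr_ae
    filter_upwards [hP.eq, hP.fst_eq, hP.snd_eq] with x h2 h3 h4
    rw [inner_plane, inner_plane, h3, h4, h2]
    simp [smoothGrad, slope]
    ring
  obtain ⟨U, hU⟩ := hdiv.exists_isFlux hlr hH hzb
  -- Elements of `Q` need not vanish on `Γ`, so orthogonality to their gradients leaves exactly the
  -- boundary terms; `x - r` and `x - l` then isolate the two end points.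
  have hend : ∀ P : ℝ → ℝ, ContDiffOn ℝ 1 P (Icc l r) → U r * P r - U l * P l = 0 := by
    intro P hPc
    obtain ⟨q, G, hP⟩ := exists_isPressure_of_contDiffOn hlr hH hzb hPc
    have h1 := hU.integral_add hlr hP
    rw [← L2.inner_eq_integral_mul, inner_zero_left, zero_add, ← L2.inner_def,
      h q G (hP.hasWeakGrad hlr hH)] at h1
    exact h1.symm
  have hl := hend (fun x => x - r) (contDiff_id.sub contDiff_const).contDiffOn
  have hr := hend (fun x => x - l) (contDiff_id.sub contDiff_const).contDiffOn
  have hl0 : U l = 0 := by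
    rcases mul_eq_zero.1 (show U l * (l - r) = 0 by linarith) with h0 | h0
    · exact h0
    · linarith
  have hr0 : U r = 0 := by
    rcases mul_eq_zero.1 (show U r * (r - l) = 0 by linarith) with h0 | h0
    · exact h0
    · linarith
  refine ⟨hdiv, fun x => U x * (H x)⁻¹, ?_, ?_, by simp [hl0], by simp [hr0]⟩
  · exact (hU.ac.continuousOn_Icc hlr).mul
      (hH.continuousOn.inv₀ fun x hx => (hpos x hx).ne')
  · filter_upwards [hU.eq, ae_vol_mem l r] with x h1 hx
    have := (hpos x (Ioo_subset_Icc_self hx)).ne'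
    rw [← h1]
    field_simp

/-- Solvability of the weighted Neumann problem in the space of gradients. -/
theorem exists_mem_inner_mulL_eq {m : ℝ → ℝ} (hm : MemLp m ⊤ (vol l r)) {c : ℝ} (hc : 0 < c)
    (hcm : ∀ x ∈ Icc l r, c ≤ m x) {R : Submodule ℝ (L2Vec l r)}
    (hR : IsClosed (R : Set (L2Vec l r))) (f : L2Vec l r) :
    ∃ G ∈ R, ∀ G' ∈ R, inner ℝ (mulL hm G) G' = inner ℝ f G' := by
  have : CompleteSpace R := hR.completeSpace_coe
  let B : R →L[ℝ] R →L[ℝ] ℝ :=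
    ((innerSL ℝ).comp (mulL hm)).bilinearComp R.subtypeL R.subtypeL
  -- Lax–Milgram on the subspace `R`, with `F` the Riesz representative of the right-hand side.
  have hB : IsCoercive B := ⟨c, hc, fun G => by
    rw [mul_assoc, ← sq]
    exact mul_norm_sq_le_inner_mulL hm hcm (G : L2Vec l r)⟩
  let F : R := (InnerProductSpace.toDual ℝ R).symm ((innerSL ℝ f).comp R.subtypeL)
  refine ⟨hB.continuousLinearEquivOfBilin.symm F, Subtype.coe_prop _, fun G' hG' => ?_⟩
  have h1 := hB.continuousLinearEquivOfBilin_apply (hB.continuousLinearEquivOfBilin.symm F)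
    ⟨G', hG'⟩
  rw [ContinuousLinearEquiv.apply_symm_apply, InnerProductSpace.toDual_symm_apply] at h1
  exact h1.symm

theorem exists_isMixedSolution (hlr : l < r) (hH : ContDiffOn ℝ 1 H (Icc l r))
    (hzb : ContDiffOn ℝ 1 zb (Icc l r)) (hpos : ∀ x ∈ Icc l r, 0 < H x) {dt : ℝ} (hdt : 0 < dt)
    (u₀ : L2Vec l r) : ∃ u p, IsMixedSolution H zb dt u₀ u p := by
  have hinv : ContinuousOn (fun x => (H x)⁻¹) (Icc l r) :=
    hH.continuousOn.inv₀ fun x hx => (hpos x hx).ne'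
  -- The minimum of `H⁻¹` on the compact interval is the coercivity constant of the weight.
  obtain ⟨x₀, hx₀, hmin⟩ := isCompact_Icc.exists_isMinOn (nonempty_Icc.2 hlr.le) hinv
  have hm := memLp_top_of_continuousOn hinv
  obtain ⟨G, hG, hGeq⟩ := exists_mem_inner_mulL_eq hm (inv_pos.2 (hpos x₀ hx₀))
    (fun x hx => hmin hx) (isClosed_gradRange hlr hH hzb) (dt⁻¹ • u₀)
  obtain ⟨p, hp⟩ := (mem_gradRange_iff hlr hH hzb).1 hG
  obtain ⟨hdiv, htr⟩ := hasWeakDiv_zero_of_inner_grad hlr hH hzb hpos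
    (u := u₀ - dt • mulL hm G) fun q G' hG' => by
      have h1 := hGeq G' ((mem_gradRange_iff hlr hH hzb).2 ⟨q, hG'⟩)
      rw [real_inner_smul_left] at h1
      rw [inner_sub_right, real_inner_smul_right, real_inner_comm, real_inner_comm _ G', h1]
      field_simp
      ring
  refine ⟨u₀ - dt • mulL hm G, p, ⟨⟨0, hdiv⟩, htr⟩, ⟨G, hp⟩, fun v hv => ?_, fun q hq => ?_⟩
  · rw [formB_eq_inner_gradSW hlr hH hzb hpos hv ⟨G, hp⟩, hp.gradSW_eq]
    have hHt := memLp_top_of_continuousOn hH.continuousOn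
    have e : mulL hHt (mulL hm G) = G := by
      apply Lp.ext
      filter_upwards [mulL_apply hHt (mulL hm G), mulL_apply hm G, ae_vol_mem l r] with x h1 h2 hx
      rw [h1, h2, smul_smul, mul_inv_cancel₀ (hpos x (Ioo_subset_Icc_self hx)).ne', one_smul]
    have f1 : formA H (u₀ - dt • mulL hm G) v = formA H u₀ v - dt * inner ℝ G v := by
      rw [formA, ← inner_mulL hHt, map_sub, map_smul, e, inner_sub_left, real_inner_smul_left,
        inner_mulL, formA]
    rw [f1]
    field_simp
    ring
  · rw [hdiv.formB_eq, inner_zero_left, neg_zero]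

/-- The difference of the velocities is divergence free, so the pressure terms drop out and
coercivity of `a` makes it zero. The vertical field `(0, p - p')` then separates the pressures. -/
theorem IsMixedSolution.unique (hlr : l < r) (hH : ContDiffOn ℝ 1 H (Icc l r))
    (hzb : ContDiffOn ℝ 1 zb (Icc l r)) {H₀ : ℝ} (hH₀ : 0 < H₀) (hHH₀ : ∀ x ∈ Icc l r, H₀ ≤ H x)
    {dt : ℝ} (hdt : 0 < dt) {u₀ u u' : L2Vec l r} {p p' : L2 l r}
    (h : IsMixedSolution H zb dt u₀ u p) (h' : IsMixedSolution H zb dt u₀ u' p') :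
    u = u' ∧ p = p' := by
  obtain ⟨hu, hp, h1, h2⟩ := h
  obtain ⟨hu', hp', h1', h2'⟩ := h'
  have hHt := memLp_top_of_continuousOn hH.continuousOn
  have hw : u - u' ∈ V0 l r H zb := (V0Submodule hlr hH hzb).sub_mem hu hu'
  obtain ⟨⟨g, hg⟩, -⟩ := hu
  obtain ⟨⟨g', hg'⟩, -⟩ := hu'
  have hg0 := hg.eq_zero_of_formB_eq_zero hlr hH hzb h2
  have hg0' := hg'.eq_zero_of_formB_eq_zero hlr hH hzb h2'
  have hd : HasWeakDiv H zb (u - u') 0 := by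
    have := hg.add hlr hH hzb (hg'.smul hlr hH hzb (-1))
    rw [hg0, hg0', smul_zero, add_zero, neg_one_smul, ← sub_eq_add_neg] at this
    exact this
  have hA : ∀ q, formB H zb (u - u') q = 0 := fun q => by
    rw [hd.formB_eq, inner_zero_left, neg_zero]
  have k1 := h1 _ hw
  have k1' := h1' _ hw
  rw [hA] at k1 k1'
  have k : formA H (u - u') (u - u') = 0 := by
    have e : formA H (u - u') (u - u') = formA H u (u - u') - formA H u' (u - u') := by
      simp only [formA]
      rw [← inner_mulL hHt, ← inner_mulL hHt, ← inner_mulL hHt, map_sub, inner_sub_left]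
    have k2 : 1 / dt * formA H u (u - u') = 1 / dt * formA H u' (u - u') := by linarith
    rw [e, mul_left_cancel₀ (one_div_pos.2 hdt).ne' k2, sub_self]
  have hc := mul_norm_sq_le_inner_mulL hHt hHH₀ (u - u')
  rw [inner_mulL, ← formA, k] at hc
  have huu : u = u' := by
    have : ‖u - u'‖ ^ 2 = 0 := by nlinarith [sq_nonneg ‖u - u'‖]
    exact sub_eq_zero.1 (norm_eq_zero.1 (pow_eq_zero_iff two_ne_zero |>.1 this))
  refine ⟨huu, ?_⟩
  subst huu
  have j := h1 _ (vertical_mem_V0 hlr hH hzb (p - p'))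
  have j' := h1' _ (vertical_mem_V0 hlr hH hzb (p - p'))
  rw [formB_vertical hlr hH hzb] at j j'
  have : inner ℝ (p - p') (p - p') = 0 := by
    rw [inner_sub_right]
    linarith
  exact sub_eq_zero.1 (inner_self_eq_zero.1 this)

end WellPosed

end ShallowWater

end

/-! ### Coercivity, kernels and the assembled theorem -/

open ShallowWater in
theorem mainTheorem1 (l r : ℝ) (hlr : l < r) (H zb : ℝ → ℝ)
    (hH : ContDiffOn ℝ 1 H (Set.Icc l r)) (hzb : ContDiffOn ℝ 1 zb (Set.Icc l r))
    (H₀ : ℝ) (hH₀ : 0 < H₀) (hHH₀ : ∀ x ∈ Set.Icc l r, H₀ ≤ H x) :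
    -- coercivity of `a`: in the `L²` norm on `V₀`, in the graph norm on `ker B`
    (∀ v ∈ V0 l r H zb, H₀ * ‖v‖ ^ 2 ≤ formA H v v) ∧
    (∀ v ∈ kerB l r H zb, H₀ * graphNormV H zb v ^ 2 ≤ formA H v v) ∧
    -- the kernel of the transposed operator
    kerBt l r H zb = {q ∈ Q l r H zb | ∀ v ∈ V0 l r H zb,
      ∫ x, inner ℝ (gradSW H zb q x) (v x) ∂(vol l r) = 0} ∧
    (∀ q ∈ Q l r H zb, gradSW H zb q = 0 → q = 0) ∧
    kerBt l r H zb = {0} ∧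
    -- the inf-sup condition, for both pairs of norms
    InfSup l r H zb (fun v => ‖v‖) (graphNormQ H zb) ∧
    InfSup l r H zb (graphNormV H zb) (fun q => ‖q‖) ∧
    -- unique solvability of the mixed problem
    (∀ dt : ℝ, 0 < dt → ∀ u₀ : L2Vec l r,
      ∃! s : L2Vec l r × L2 l r, IsMixedSolution H zb dt u₀ s.1 s.2) := by
  have hpos : ∀ x ∈ Set.Icc l r, 0 < H x := fun x hx => hH₀.trans_le (hHH₀ x hx)
  have hHt := memLp_top_of_continuousOn hH.continuousOn
  have hcoer : ∀ v : L2Vec l r, H₀ * ‖v‖ ^ 2 ≤ formA H v v := fun v => by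
    have := mul_norm_sq_le_inner_mulL hHt hHH₀ v
    rwa [inner_mulL] at this
  refine ⟨fun v _ => hcoer v, fun v hv => ?_, ?_, fun q hq h0 => ?_, ?_,
    infSup_norm_graphNormQ hlr hH hzb hpos, infSup_graphNormV_norm hlr hH hzb, fun dt hdt u₀ => ?_⟩
  · obtain ⟨⟨⟨g, hg⟩, -⟩, hb⟩ := hv
    -- On `ker B` the divergence vanishes, so the graph norm is the `L²` norm.
    rw [graphNormV, hg.divSW_eq, hg.eq_zero_of_formB_eq_zero hlr hH hzb hb, norm_zero,
      Real.sq_sqrt (by positivity)]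
    simpa using hcoer v
  · ext q
    refine and_congr_right fun hq => forall₂_congr fun v hv => ?_
    rw [formB_eq_inner_gradSW hlr hH hzb hpos hv hq, MeasureTheory.L2.inner_def]
  · obtain ⟨G, hG⟩ := hq
    have h1 := hG.two_mul_norm_le
    rw [← hG.gradSW_eq, h0, norm_zero] at h1
    exact norm_le_zero_iff.1 (by linarith)
  · ext q
    rw [Set.mem_singleton_iff]
    constructor
    · rintro ⟨-, h⟩
      -- The field `(0, q)` gives `b = -2‖q‖²`.
      have h1 := h _ (vertical_mem_V0 hlr hH hzb q)
      rw [formB_vertical hlr hH hzb] at h1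
      exact inner_self_eq_zero.1 (by linarith : inner ℝ q q = 0)
    · rintro rfl
      refine ⟨⟨0, IsPressure.hasWeakGrad hlr hH (P := fun _ => 0)
        ⟨ContDiffOn.ac hlr contDiffOn_const, ?_, ?_, ?_⟩⟩, fun v _ => ?_⟩
      iterate 3
        filter_upwards [MeasureTheory.Lp.coeFn_zero Plane 2 (vol l r),
          MeasureTheory.Lp.coeFn_zero ℝ 2 (vol l r)] with x h1 h2
        simp only [h1, h2, Pi.zero_apply, PiLp.zero_apply, mul_zero, add_zero, deriv_const]
      refine neg_eq_zero.2 ?_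
      rw [← L2.inner_eq_integral_mul, inner_zero_right]
  · obtain ⟨u, p, hs⟩ := exists_isMixedSolution hlr hH hzb hpos hdt u₀
    refine ⟨(u, p), hs, fun s hs' => ?_⟩
    obtain ⟨h1, h2⟩ := IsMixedSolution.unique hlr hH hzb hH₀ hHH₀ hdt hs' hs
    exact Prod.ext h1 h2
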